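/- **Setting.** Let $k$ be a field. Algebras are finite-dimensional, associative and unital. An element $\omega$ of an algebra $A$ is a *principal $n$-th root of unity* if $\omega^n=1$ and $1-\omega^\nu$ is not a zero divisor for $1\le\nu<n$. For such $\omega$, the order $n$ is *$c$-suitable* over $A$ if the map $(a_\nu)_{\nu<n}\mapsto(\sum_{\nu<n}\omega^{i\nu}a_\nu)_{i<n}$ (the DFT of order $n$) has a division-free straight-line computation with at most $c\,n\log n$ operations in $A$. An *order sequence* for $k$ is a sequence $\mathcal N=(n_i)$ of positive integers with given factorizations $n_i=n_i'n_i''$ such that $n_i<n_{i+1}$, $n_i\mid n_{i+1}$, and, with a constant $c$ independent of $i$, for every $i$ some $k$-algebra of dimension $n_i'$ contains a principal $n_i''$-th root of unity that is $c$-suitable over this algebra. It has *constant sparseness* if $n_{i+1}\le C n_i$ for a constant $C$. For $n$ not divisible by $\operatorname{char}k$ let $f_k(n)=[k(\omega_n):k]$, where $\omega_n\in\overline k$ is a primitive $n$-th root of unity. The field $k$ is *fast* if there is an order sequence of constant sparseness such that all $f_k(n_i')$ are defined and $f_k(n_i')=O(1)$. For $t:\mathbb N\to\mathbb R$ it is *$t(n)$-fast*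 if there is an order sequence of constant sparseness such that all $f_k(n_i')$ are defined and $f_k(n_i')\le t(n_i')$; it is *$t(n)$-slow* if for every order sequence of constant sparseness $f_k(n_i')\ge t(n_i')$ for all $i$ for which $f_k(n_i')$ is defined. It is *$o(\log\log n)$-fast* if it is $t(n)$-fast for some $t(n)=o(\log\log n)$, and *$\Omega(n^{1-o(1)})$-slow* if it is $t(n)$-slow for some $t$ with $t(n)\ge c\,n^{1-\varepsilon(n)}$ for all large $n$, where $c>0$ and $\varepsilon(n)\to0$. **The generic algorithm.** An instance $\mathcal D$ of the DFT-based algorithm $\mathcal D_k$ consists of an order sequence $\mathcal N$ of constant sparseness and the following choices. To multiply two polynomials of degree at most $n-1$ over $k$, it takes a monic polynomial $P_N$ of degree $N\in\mathcal N$, $2n-1\le N=O(n)$, and multiplies in $A_N=k[x]/(P_N)$. A recursive step in $A_N$ uses the factorization $N=N'N''$ given by $\mathcal N$, where $P_N(x)=P_{N'}(x^{N''})$ for a monic $P_{N'}$ of degree $N'$, so that elements of $A_N$ are polynomials in $x$ of degree less than $N''$ over $A_{N'}=k[y]/(P_{N'})$ with $y=x^{N''}$, and $A_{N'}$ contains a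 principal $N''$-th root of unity $\omega$ and units $\gamma_1,\gamma_2$ with $\gamma_1^{N''}-\gamma_2^{N''}$ a unit. The step evaluates both factors at the $2N''$ points $\gamma_1\omega^j,\gamma_2\omega^j$ ($0\le j<N''$) by two DFTs of order $N''$ over $A_{N'}$ (after twisting the coefficients by powers of $\gamma_1$, resp. $\gamma_2$), multiplies the $2N''$ pairs of values in $A_{N'}$ recursively, interpolates the product by inverse DFTs, and reduces it by $x^{N''}=y$. DFTs are computed by Cooley–Tukey reductions down to DFTs computed directly from the definition. The recursion stops at an algebra $A_{N'}$ with $N'=O(1)$, where elements are multiplied directly. Let $L_{\mathcal D}(n)$ be the number of operations in $k$ that $\mathcal D$ performs; an addition or subtraction in $A_{N'}$ counts $N'$ operations, a multiplication by a fixed element of $A_{N'}$ counts the straight-line complexity over $k$ of this linear map, and a direct multiplication counts its straight-line complexity over $k$. The constants in $N=O(n)$ and $N'=O(1)$ belong to the instance. An upper bound for $L_{\mathcal D_k}$ means that some instance satisfies it, a lower bound that every instance satisfies it (with implied constants that may depend on $k$ and the instance). **Statement.** 1. If $k$ is fast, then $L_{\mathcal D_k}(n)=O(n\log n)$. 2.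 If $k$ is $o(\log\log n)$-fast, then $L_{\mathcal D_k}(n)=o(n\log n\log\log n)$. 3. If $k$ is $\Omega(n^{1-o(1)})$-slow, then $L_{\mathcal D_k}(n)=\Omega(n\log n\log\log n)$. -/

import Mathlib

namespace DFTMul

open Polynomial Filter

universe u

/-! ### Straight-line computations -/

/-- `StraightLine V t S`: with `t` arithmetic operations, starting from the input functions
`ins` on the input space `V` and from all constants of `R`, one can compute all functions in `S`. -/
inductive StraightLine {R V : Type*} [Ring R] (ins : Set (V → R)) : ℕ → Set (V → R) → Prop
  | start : StraightLine ins 0 (ins ∪ Set.range fun (c : R) (_ : V) => c)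
  | add {t : ℕ} {S : Set (V → R)} {f g : V → R} :
      StraightLine ins t S → f ∈ S → g ∈ S → StraightLine ins (t + 1) (insert (f + g) S)
  | sub {t : ℕ} {S : Set (V → R)} {f g : V → R} :
      StraightLine ins t S → f ∈ S → g ∈ S → StraightLine ins (t + 1) (insert (f - g) S)
  | mul {t : ℕ} {S : Set (V → R)} {f g : V → R} :
      StraightLine ins t S → f ∈ S → g ∈ S → StraightLine ins (t + 1) (insert (f * g) S)

/-- Total algebraic complexity over `R` of a map `F : R^ι → R^κ`: the least number of additions,
subtractions and multiplications in `R` of a division-free straight-line computation of all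
coordinates of `F` (constants of `R` are free).  Every map to which this is applied below is
polynomial, so that such a computation exists. -/
noncomputable def complexity {R ι κ : Type*} [Ring R] (F : (ι → R) → (κ → R)) : ℕ :=
  sInf {t | ∃ S : Set ((ι → R) → R),
    StraightLine (Set.range fun (i : ι) (v : ι → R) => v i) t S ∧ ∀ j, (fun v => F v j) ∈ S}

/-! ### Principal roots of unity, order sequences, degree function -/

/-- `ω` is a principal `n`-th root of unity in `A`. -/
def IsPrincipalRoot {A : Type*} [Ring A] (ω : A) (n : ℕ) : Prop :=
  ω ^ n = 1 ∧ ∀ ν, 1 ≤ ν → ν < n → 1 - ω ^ ν ∈ nonZeroDivisors A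

/-- The discrete Fourier transform of order `n` over `A` with respect to `ω`. -/
def dft {A : Type*} [Ring A] (ω : A) (n : ℕ) (a : Fin n → A) : Fin n → A :=
  fun i => ∑ ν : Fin n, ω ^ ((i : ℕ) * (ν : ℕ)) * a ν

/-- The order `n` (with the root `ω`) is `c`-suitable over `A`. -/
def IsSuitable {A : Type*} [Ring A] (ω : A) (n : ℕ) (c : ℝ) : Prop :=
  IsPrincipalRoot ω n ∧ (complexity (dft ω n) : ℝ) ≤ c * n * Real.log n

/-- An order sequence `n_i = n_i' n_i''` for `k`, with `fst i = n_i'` and `snd i = n_i''`.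
It comes with its factorization; its sparseness is recorded by `HasSparseness`. -/
structure OrderSequence (k : Type u) [Field k] where
  fst : ℕ → ℕ
  snd : ℕ → ℕ
  lt : ∀ i, fst i * snd i < fst (i + 1) * snd (i + 1)
  dvd : ∀ i, fst i * snd i ∣ fst (i + 1) * snd (i + 1)
  /-- there are ring extensions of `k` of degree `n_i'` that contain a principal `n_i''`-th root
  of unity which is `c`-suitable there, with one constant `c` for all `i` -/
  ext : ∃ c : ℝ, ∀ i, ∃ (A : Type u) (_ : Ring A) (_ : Algebra k A),
    Module.finrank k A = fst i ∧ ∃ ω : A, IsSuitable ω (snd i) c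

/-- The element `n_i` of the sequence. -/
def OrderSequence.elt {k : Type u} [Field k] (𝒩 : OrderSequence k) (i : ℕ) : ℕ :=
  𝒩.fst i * 𝒩.snd i

/-- `𝒩` has sparseness `s`. -/
def OrderSequence.HasSparseness {k : Type u} [Field k] (𝒩 : OrderSequence k) (s : ℕ → ℝ) : Prop :=
  (∀ n, 1 < s n) ∧ ∀ i, (𝒩.elt (i + 1) : ℝ) ≤ s (𝒩.elt i) * 𝒩.elt i

/-- `𝒩` has constant sparseness. -/
def OrderSequence.ConstantSparseness {k : Type u} [Field k] (𝒩 : OrderSequence k) : Prop :=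
  ∃ (s : ℕ → ℝ) (C : ℝ), 𝒩.HasSparseness s ∧ ∀ n, s n ≤ C

/-- The degree function `f_k(n) = [k(ω_n) : k]`, where `ω_n` is a primitive `n`-th root of unity
in the algebraic closure of `k`.  It is meaningful if `n ≠ 0` in `k`, that is, if `ω_n` exists. -/
noncomputable def degreeFunction (k : Type u) [Field k] (n : ℕ) : ℕ :=
  Module.finrank k
    (IntermediateField.adjoin k {ω : AlgebraicClosure k | IsPrimitiveRoot ω n})

/-- `k` is a fast field. -/
def IsFast (k : Type u) [Field k] : Prop :=
  ∃ 𝒩 : OrderSequence k, 𝒩.ConstantSparseness ∧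
    ∃ C : ℕ, ∀ i, (𝒩.fst i : k) ≠ 0 ∧ degreeFunction k (𝒩.fst i) ≤ C

/-- `k` is a `t(n)`-fast field. -/
def IsFastWith (k : Type u) [Field k] (t : ℕ → ℝ) : Prop :=
  ∃ 𝒩 : OrderSequence k, 𝒩.ConstantSparseness ∧
    ∀ i, (𝒩.fst i : k) ≠ 0 ∧ (degreeFunction k (𝒩.fst i) : ℝ) ≤ t (𝒩.fst i)

/-- `k` is a `t(n)`-slow field. -/
def IsSlowWith (k : Type u) [Field k] (t : ℕ → ℝ) : Prop :=
  ∀ 𝒩 : OrderSequence k, 𝒩.ConstantSparseness →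
    ∀ i, (𝒩.fst i : k) ≠ 0 → t (𝒩.fst i) ≤ (degreeFunction k (𝒩.fst i) : ℝ)

/-- `t(n) = Ω(n^(1 - o(1)))`. -/
def IsOmegaNearlyLinear (t : ℕ → ℝ) : Prop :=
  ∃ ε : ℕ → ℝ, Tendsto ε atTop (nhds 0) ∧
    ∃ c : ℝ, 0 < c ∧ ∀ᶠ n : ℕ in atTop, c * (n : ℝ) ^ (1 - ε n) ≤ t n

/-! ### Computations with a count of the operations in `k` -/

/-- A computed value together with the number of arithmetic operations in `k` spent on it. -/
structure Counted (α : Type*) where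
  val : α
  ops : ℕ

instance : Monad Counted where
  pure a := ⟨a, 0⟩
  bind x f := ⟨(f x.val).val, x.ops + (f x.val).ops⟩

/-- Carry out the computations `f 0, …, f (n - 1)`. -/
def Counted.vec {α : Type*} (n : ℕ) (f : ℕ → Counted α) : Counted (ℕ → α) :=
  ⟨fun i => (f i).val, ∑ i ∈ Finset.range n, (f i).ops⟩

section Arithmetic

variable {k : Type u} [Field k]

/-! Elements of `k[y]/P(y)` are represented by polynomials of degree less than `deg P`. -/

/-- Addition in `k[y]/P(y)`: one operation for each of the `deg P` coefficients. -/
noncomputable def addMod (P a b : k[X]) : Counted k[X] := ⟨a + b, P.natDegree⟩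

/-- Subtraction in `k[y]/P(y)`. -/
noncomputable def subMod (P a b : k[X]) : Counted k[X] := ⟨a - b, P.natDegree⟩

/-- The polynomial with the given coefficient vector. -/
noncomputable def ofCoeffs {d : ℕ} (v : Fin d → k) : k[X] := ∑ i : Fin d, C (v i) * X ^ (i : ℕ)

/-- The number of operations in `k` needed to multiply an element of `k[y]/P(y)` by the fixed
element `w`. -/
noncomputable def scaleCost (P w : k[X]) : ℕ :=
  complexity fun (v : Fin P.natDegree → k) (j : Fin P.natDegree) =>
    ((w * ofCoeffs v) %ₘ P).coeff j

/-- The number of operations in `k` needed to multiply two elements of `k[y]/P(y)`. -/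
noncomputable def mulCost (P : k[X]) : ℕ :=
  complexity fun (v : Fin P.natDegree ⊕ Fin P.natDegree → k) (j : Fin P.natDegree) =>
    ((ofCoeffs (fun i => v (Sum.inl i)) * ofCoeffs (fun i => v (Sum.inr i))) %ₘ P).coeff j

/-- Multiplication of `a` by the fixed element `w` in `k[y]/P(y)`. -/
noncomputable def scaleMod (P w a : k[X]) : Counted k[X] := ⟨(w * a) %ₘ P, scaleCost P w⟩

/-- The sum `a 0 + ⋯ + a (n - 1)` in `k[y]/P(y)`, with `n - 1` additions. -/
noncomputable def sumMod (P : k[X]) : ℕ → (ℕ → k[X]) → Counted k[X]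
  | 0, _ => pure 0
  | 1, a => pure (a 0)
  | n + 2, a => do
      let s ← sumMod P (n + 1) a
      addMod P s (a (n + 1))

/-! ### The fast Fourier transform -/

/-- How to compute a DFT: from the definition, or by a Cooley–Tukey reduction of order `n₁ n₂`
to orders `n₁` and `n₂`. -/
inductive FFTPlan
  | direct (n : ℕ)
  | cooleyTukey (p q : FFTPlan)

/-- The order of the DFT that is computed. -/
def FFTPlan.order : FFTPlan → ℕ
  | direct n => n
  | cooleyTukey p q => p.order * q.order

/-- The DFT of `a 0, …, a (n - 1)` over `k[y]/P(y)` with respect to `ω`. -/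
noncomputable def FFTPlan.run (P : k[X]) : FFTPlan → k[X] → (ℕ → k[X]) → Counted (ℕ → k[X])
  | direct n, ω, a => Counted.vec n fun i => do
      let t ← Counted.vec n fun ν => scaleMod P (ω ^ (i * ν)) (a ν)
      sumMod P n t
  | cooleyTukey p q, ω, a => do
      let b ← Counted.vec q.order fun μ =>
        p.run P (ω ^ q.order) fun ν => a (q.order * ν + μ)
      let b' ← Counted.vec q.order fun μ =>
        Counted.vec p.order fun l => scaleMod P (ω ^ (μ * l)) (b μ l)
      let c ← Counted.vec p.order fun l =>
        q.run P (ω ^ p.order) fun μ => b' μ l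
      pure fun i => c (i % p.order) (i / p.order)

/-! ### The generic DFT-based multiplication algorithm

One recursive step reduces the multiplication in `A_N = k[x]/P_N(x)`, `N = N' N''`, to `2 N''`
multiplications in `A_{N'} = k[y]/P_{N'}(y)`.  Here `P_N(x) = P_{N'}(x^{N''})`, so that with
`y = x^{N''}` an element of `A_N` is a polynomial in `x` of degree less than `N''` over `A_{N'}`,
and the embedding `ψ` sends it to its values at the `2 N''` points `γ₁ ω^j` and `γ₂ ω^j`
(`0 ≤ j < N''`), where `ω` is a principal `N''`-th root of unity in `A_{N'}`.
For `γ₁ = 1` and `γ₂` a principal `2 N''`-th root of unity with `γ₂² = ω` this is the DFT of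
order `2 N''`. -/

/-- The choices made in one recursive step. -/
structure StepData (k : Type u) [Field k] where
  /-- `P_{N'}` -/
  modulus : k[X]
  /-- how the DFTs of order `N''` are computed -/
  fft : FFTPlan
  ω : k[X]
  γ₁ : k[X]
  γ₂ : k[X]
  /-- inverse of `γ₁` in `A_{N'}` -/
  γ₁inv : k[X]
  /-- inverse of `γ₂` in `A_{N'}` -/
  γ₂inv : k[X]
  /-- inverse of `γ₁ ^ N'' - γ₂ ^ N''` in `A_{N'}` -/
  δinv : k[X]

/-- `N''` -/
def StepData.order (d : StepData k) : ℕ := d.fft.order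

/-- The choices are admissible. -/
def StepData.Valid (d : StepData k) : Prop :=
  d.modulus.Monic ∧
  IsPrincipalRoot (AdjoinRoot.mk d.modulus d.ω) d.order ∧
  AdjoinRoot.mk d.modulus (d.γ₁ * d.γ₁inv) = 1 ∧
  AdjoinRoot.mk d.modulus (d.γ₂ * d.γ₂inv) = 1 ∧
  AdjoinRoot.mk d.modulus ((d.γ₁ ^ d.order - d.γ₂ ^ d.order) * d.δinv) = 1

/-- The coefficient `a_i(y)` in `a(x) = ∑_{i < m} a_i(x^m) x^i`. -/
noncomputable def block (m i : ℕ) (a : k[X]) : k[X] := contract m (divX^[i] a)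

/-- Values of `a` at the points `γ ω^j`, `j < N''`: twist by powers of `γ`, then a DFT. -/
noncomputable def StepData.transform (d : StepData k) (γ a : k[X]) : Counted (ℕ → k[X]) := do
  let t ← Counted.vec d.order fun i => scaleMod d.modulus (γ ^ i) (block d.order i a)
  d.fft.run d.modulus d.ω t

/-- The inverse of `transform` on polynomials of degree less than `N''` over `A_{N'}`. -/
noncomputable def StepData.backTransform (d : StepData k) (γinv : k[X]) (c : ℕ → k[X]) :
    Counted (ℕ → k[X]) := do
  let t ← d.fft.run d.modulus (d.ω ^ (d.order - 1)) c
  Counted.vec d.order fun i =>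
    scaleMod d.modulus (C ((d.order : k)⁻¹) * γinv ^ i) (t i)

/-- A recursion scheme: multiply directly, or make a recursive step. -/
inductive Scheme (k : Type u) [Field k]
  | base
  | step (d : StepData k) (next : Scheme k)

/-- The scheme is admissible for multiplication in `k[x]/P(x)`: each step uses a number
`N = N' N''` of the order sequence, and the recursion stops at a modulus of degree at most `B`. -/
def Scheme.Valid (𝒩 : OrderSequence k) (B : ℕ) : Scheme k → k[X] → Prop
  | base, P => P.natDegree ≤ B
  | step d next, P =>
      d.Valid ∧ P = expand k d.order d.modulus ∧
      (∃ i, d.modulus.natDegree = 𝒩.fst i ∧ d.order = 𝒩.snd i) ∧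
      next.Valid 𝒩 B d.modulus

/-- Multiplication in `k[x]/P(x)`. -/
noncomputable def Scheme.run : Scheme k → k[X] → k[X] → k[X] → Counted k[X]
  | base, P, a, b => ⟨(a * b) %ₘ P, mulCost P⟩
  | step d next, _, a, b => do
      -- transform
      let a₁ ← d.transform d.γ₁ a
      let a₂ ← d.transform d.γ₂ a
      let b₁ ← d.transform d.γ₁ b
      let b₂ ← d.transform d.γ₂ b
      -- multiply the `2 N''` coordinates recursively
      let c₁ ← Counted.vec d.order fun j => next.run d.modulus (a₁ j) (b₁ j)
      let c₂ ← Counted.vec d.order fun j => next.run d.modulus (a₂ j) (b₂ j)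
      -- back-transform: the product is `∑_{i < N''} (lo_i + hi_i x^{N''}) x^i` over `A_{N'}`,
      -- and `u_i = lo_i + γ₁^{N''} hi_i`, `v_i = lo_i + γ₂^{N''} hi_i`
      let u ← d.backTransform d.γ₁inv c₁
      let v ← d.backTransform d.γ₂inv c₂
      let r ← Counted.vec d.order fun i => do
        let e ← subMod d.modulus (u i) (v i)
        let hi ← scaleMod d.modulus d.δinv e
        let e' ← scaleMod d.modulus (d.γ₁ ^ d.order) hi
        let lo ← subMod d.modulus (u i) e'
        -- unembed: `x^{N''} = y`
        let z ← scaleMod d.modulus X hi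
        addMod d.modulus lo z
      pure (∑ i ∈ Finset.range d.order, expand k d.order (r i) * X ^ i)

end Arithmetic

/-- An instance `𝒟` of the generic DFT-based algorithm over `k`: an order sequence of constant
sparseness and, for each `n`, a modulus `P_N` with `2n - 1 ≤ N = O(n)`, `N ∈ 𝒩`, and a recursion
scheme for the multiplication in `k[x]/P_N(x)` that ends with a modulus of degree `O(1)`. -/
structure Algorithm (k : Type u) [Field k] where
  seq : OrderSequence k
  sparse : seq.ConstantSparseness
  /-- bound for the degree at which the recursion stops -/
  bound : ℕ
  /-- constant in `N = O(n)` -/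
  ratio : ℕ
  modulus : ℕ → k[X]
  scheme : ℕ → Scheme k
  valid : ∀ n, 1 ≤ n →
    (modulus n).Monic ∧ (∃ i, (modulus n).natDegree = seq.elt i) ∧
    2 * n - 1 ≤ (modulus n).natDegree ∧ (modulus n).natDegree ≤ ratio * n ∧
    (scheme n).Valid seq bound (modulus n)

/-- The algorithm, applied to two polynomials of degree less than `n`. -/
noncomputable def Algorithm.run {k : Type u} [Field k] (D : Algorithm k) (n : ℕ) (a b : k[X]) :
    Counted k[X] :=
  (D.scheme n).run (D.modulus n) a b

/-- `L_𝒟(n)`: the (worst-case) number of operations in `k` that `𝒟` performs on two polynomials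
of degree at most `n - 1`.  (The number is in fact the same for all inputs.) -/
noncomputable def Algorithm.cost {k : Type u} [Field k] (D : Algorithm k) (n : ℕ) : ℕ :=
  sSup {t | ∃ a b : k[X], a.degree < n ∧ b.degree < n ∧ t = (D.run n a b).ops}

end DFTMul

/-! Everything rests on a dichotomy for the degree function f along the powers of a prime p that is
nonzero in k: either f(p^e) stays bounded, or from some e on every further factor p multiplies the
degree by p (`degreeFunction_bounded_or`). The reason is Kummer-like. Adjoining a p-th root z of an
element x that is no p-th power gives degree p, and taking norms shows that z is again no p-th power
(`pow_ne_gen`).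

Constant sparseness confines the primes dividing the n_i to a finite set. If f is unbounded along
the powers of every prime, then n ≤ c·f(n) for all n that occur (`exists_le_mul_degreeFunction`). A
principal n''-th root of unity in an algebra of dimension n' forces f(n'') ≤ n'
(`IsPrincipalRoot.degreeFunction_le`), so n'' ≤ c·n'.

Slow fields: slowness, tested on the sequence p^i = p^i·1, makes f unbounded along every prime.
Because N'' ≤ c·N', a recursive step at most halves log N + log c, so about log log N levels are
needed. The additions in the six DFTs of a step cost at least 6·N·log N'', and a potential argument
sums this to N log N log log N (`Scheme.le_cost`).

Fast fields: if f were unbounded along every prime, then n_i' → ∞ and n_i' ≤ c·f(n_i') would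
contradict f(n_i') ≤ t(n_i') with t(n) = o(n). So f is bounded along the powers of one prime p, and
one finite extension k[x]/(P) contains all roots of unity of p-power order. A single recursive step
with N' = deg P and a radix-p FFT then costs O(n log n). This proves the first two claims together,
since a constant bound is o(log log n). -/

namespace DFTMul

open Polynomial Filter

universe u

/-! ### The number of operations does not depend on the operands -/

@[simp] theorem Counted.ops_bind {α β : Type u} (x : Counted α) (f : α → Counted β) :
    (x >>= f).ops = x.ops + (f x.val).ops := rfl

@[simp] theorem Counted.ops_pure {α : Type*} (a : α) : (pure a : Counted α).ops = 0 := rfl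

@[simp] theorem Counted.ops_vec {α : Type*} (n : ℕ) (f : ℕ → Counted α) :
    (Counted.vec n f).ops = ∑ i ∈ Finset.range n, (f i).ops := rfl

section Cost

variable {k : Type u} [Field k]

@[simp] theorem ops_addMod (P a b : k[X]) : (addMod P a b).ops = P.natDegree := rfl

@[simp] theorem ops_subMod (P a b : k[X]) : (subMod P a b).ops = P.natDegree := rfl

@[simp] theorem ops_scaleMod (P w a : k[X]) : (scaleMod P w a).ops = scaleCost P w := rfl

@[simp] theorem ops_sumMod (P : k[X]) (n : ℕ) (a : ℕ → k[X]) :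
    (sumMod P n a).ops = (n - 1) * P.natDegree := by
  induction n with
  | zero => simp [sumMod]
  | succ n ih =>
    cases n with
    | zero => simp [sumMod]
    | succ n =>
      rw [sumMod, Counted.ops_bind, ih, ops_addMod]
      simp only [Nat.add_sub_cancel]
      ring

/-- The number of operations of `FFTPlan.run`. -/
noncomputable def FFTPlan.cost (P : k[X]) : FFTPlan → k[X] → ℕ
  | direct n, ω =>
      ∑ i ∈ Finset.range n,
        (∑ ν ∈ Finset.range n, scaleCost P (ω ^ (i * ν)) + (n - 1) * P.natDegree)
  | cooleyTukey p q, ω =>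
      q.order * p.cost P (ω ^ q.order) +
      (∑ μ ∈ Finset.range q.order, ∑ l ∈ Finset.range p.order, scaleCost P (ω ^ (μ * l)) +
        p.order * q.cost P (ω ^ p.order))

@[simp] theorem FFTPlan.ops_run (P : k[X]) (F : FFTPlan) (ω : k[X]) (a : ℕ → k[X]) :
    (F.run P ω a).ops = F.cost P ω := by
  induction F generalizing ω a with
  | direct n => simp [FFTPlan.run, FFTPlan.cost]
  | cooleyTukey p q hp hq => simp [FFTPlan.run, FFTPlan.cost, hp, hq]

/-- The number of operations of one recursive step, apart from the recursive multiplications. -/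
noncomputable def StepData.overhead (d : StepData k) : ℕ :=
  2 * ∑ i ∈ Finset.range d.order, scaleCost d.modulus (d.γ₁ ^ i) +
  2 * ∑ i ∈ Finset.range d.order, scaleCost d.modulus (d.γ₂ ^ i) +
  4 * d.fft.cost d.modulus d.ω +
  2 * d.fft.cost d.modulus (d.ω ^ (d.order - 1)) +
  ∑ i ∈ Finset.range d.order, scaleCost d.modulus (C ((d.order : k)⁻¹) * d.γ₁inv ^ i) +
  ∑ i ∈ Finset.range d.order, scaleCost d.modulus (C ((d.order : k)⁻¹) * d.γ₂inv ^ i) +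
  d.order * (3 * d.modulus.natDegree + scaleCost d.modulus d.δinv +
    scaleCost d.modulus (d.γ₁ ^ d.order) + scaleCost d.modulus X)

/-- The number of operations of `Scheme.run`. -/
noncomputable def Scheme.cost : Scheme k → k[X] → ℕ
  | base, P => mulCost P
  | step d next, _ => d.overhead + 2 * d.order * next.cost d.modulus

@[simp] theorem Scheme.ops_run (s : Scheme k) (P a b : k[X]) : (s.run P a b).ops = s.cost P := by
  induction s generalizing P a b with
  | base => rfl
  | step d next ih =>
    simp only [Scheme.run, Scheme.cost, StepData.overhead, StepData.transform,
      StepData.backTransform, Counted.ops_bind, Counted.ops_vec, Counted.ops_pure, ops_scaleMod,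
      ops_subMod, ops_addMod, FFTPlan.ops_run, ih, Finset.sum_const, Finset.card_range,
      smul_eq_mul]
    ring

theorem Algorithm.cost_eq (D : Algorithm k) (n : ℕ) :
    D.cost n = (D.scheme n).cost (D.modulus n) := by
  have : {t | ∃ a b : k[X], a.degree < n ∧ b.degree < n ∧ t = (D.run n a b).ops} =
      {(D.scheme n).cost (D.modulus n)} := by
    ext t
    simp only [Algorithm.run, Scheme.ops_run, Set.mem_ofPred_eq, Set.mem_singleton_iff]
    exact ⟨fun ⟨_, _, _, _, h⟩ => h, fun h => ⟨0, 0, by simp, by simp, h⟩⟩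
  rw [Algorithm.cost, this, csSup_singleton]

/-! ### Bounds for the cost of a DFT -/

theorem log_natCast_le_sub_one (n : ℕ) (hn : 1 ≤ n) : Real.log n ≤ ((n - 1 : ℕ) : ℝ) := by
  have h : (0 : ℝ) < n := by exact_mod_cast hn
  rw [Nat.cast_sub hn]
  simpa using Real.log_le_sub_one_of_pos h

/-- Only additions are needed for this bound. The direct method makes n(n-1) of them and n-1 ≥ log
n. A Cooley–Tukey split preserves n log n exactly, because log(pq) = log p + log q. -/
theorem FFTPlan.le_cost (P : k[X]) (F : FFTPlan) (ω : k[X]) (h : 0 < F.order) :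
    (P.natDegree : ℝ) * (F.order * Real.log F.order) ≤ F.cost P ω := by
  induction F generalizing ω with
  | direct n =>
    have h1 : n * ((n - 1) * P.natDegree) ≤ (FFTPlan.direct n).cost P ω := by
      rw [FFTPlan.cost]
      calc n * ((n - 1) * P.natDegree) = ∑ i ∈ Finset.range n, (n - 1) * P.natDegree := by simp
        _ ≤ _ := Finset.sum_le_sum fun i _ => Nat.le_add_left _ _
    have h2 : (n : ℝ) * (((n - 1 : ℕ) : ℝ) * P.natDegree) ≤ (FFTPlan.direct n).cost P ω := by
      exact_mod_cast h1
    refine le_trans ?_ h2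
    simp only [FFTPlan.order]
    have := log_natCast_le_sub_one n h
    calc (P.natDegree : ℝ) * (n * Real.log n) ≤ P.natDegree * (n * ((n - 1 : ℕ) : ℝ)) := by gcongr
      _ = _ := by ring
  | cooleyTukey p q hp hq =>
    simp only [FFTPlan.order] at h ⊢
    have hp0 : 0 < p.order := Nat.pos_of_mul_pos_right h
    have hq0 : 0 < q.order := Nat.pos_of_mul_pos_left h
    have h1 := hp (ω ^ q.order) hp0
    have h2 := hq (ω ^ p.order) hq0
    have h3 : (q.order : ℝ) * p.cost P (ω ^ q.order) + p.order * q.cost P (ω ^ p.order) ≤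
        (cooleyTukey p q).cost P ω := by
      rw [FFTPlan.cost]
      push_cast
      have : (0 : ℝ) ≤ ∑ μ ∈ Finset.range q.order, ∑ l ∈ Finset.range p.order,
        (scaleCost P (ω ^ (μ * l)) : ℝ) := by positivity
      linarith
    refine le_trans ?_ h3
    have hp' : (p.order : ℝ) ≠ 0 := by positivity
    have hq' : (q.order : ℝ) ≠ 0 := by positivity
    push_cast
    rw [Real.log_mul hp' hq']
    calc (P.natDegree : ℝ) * (p.order * q.order * (Real.log p.order + Real.log q.order))
        = q.order * (P.natDegree * (p.order * Real.log p.order)) +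
          p.order * (P.natDegree * (q.order * Real.log q.order)) := by ring
      _ ≤ _ := by gcongr

/-- The plan for a DFT of order `p ^ e` that splits off factors `p`. -/
def FFTPlan.radix (p : ℕ) : ℕ → FFTPlan
  | 0 => direct 1
  | e + 1 => cooleyTukey (direct p) (radix p e)

@[simp] theorem FFTPlan.order_radix (p e : ℕ) : (radix p e).order = p ^ e := by
  induction e with
  | zero => rfl
  | succ e ih => simp [radix, FFTPlan.order, ih, pow_succ']

/-- With a uniform price M per scaling, the cost T satisfies T(e+1) ≤ p·T(e) + O(p^e) for fixed p,
which solves to O(e·p^e). -/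
theorem FFTPlan.cost_radix_le (P : k[X]) (M : ℕ) (hM : ∀ w, scaleCost P w ≤ M) (p e : ℕ)
    (ω : k[X]) :
    (radix p e).cost P ω ≤ (e + 1) * p ^ e * (p * (M + P.natDegree) + M) := by
  have hd : ∀ n ω, (direct n).cost P ω ≤ n * (n * (M + P.natDegree)) := by
    intro n ω
    rw [FFTPlan.cost]
    refine (Finset.sum_le_card_nsmul _ _ (n * (M + P.natDegree)) fun i _ => ?_).trans (by simp)
    have : ∑ ν ∈ Finset.range n, scaleCost P (ω ^ (i * ν)) ≤ n * M :=
      (Finset.sum_le_card_nsmul _ _ M fun ν _ => hM _).trans (by simp)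
    have h2 : (n - 1) * P.natDegree ≤ n * P.natDegree := Nat.mul_le_mul_right _ (Nat.sub_le _ _)
    rw [mul_add]
    exact add_le_add this h2
  induction e generalizing ω with
  | zero =>
    simp only [radix, FFTPlan.cost]
    simpa using (hM _).trans (Nat.le_add_left _ _)
  | succ e ih =>
    rw [radix, FFTPlan.cost]
    simp only [order_radix, FFTPlan.order]
    have h1 : ∑ μ ∈ Finset.range (p ^ e), ∑ l ∈ Finset.range p, scaleCost P (ω ^ (μ * l)) ≤
        p ^ e * (p * M) := by
      refine (Finset.sum_le_card_nsmul _ _ (p * M) fun μ _ => ?_).trans (by simp)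
      exact (Finset.sum_le_card_nsmul _ _ M fun ν _ => hM _).trans (by simp)
    calc _ ≤ p ^ e * (p * (p * (M + P.natDegree))) + (p ^ e * (p * M) +
          p * ((e + 1) * p ^ e * (p * (M + P.natDegree) + M))) := by
            gcongr
            · exact hd _ _
            · exact ih _
      _ = _ := by ring

end Cost

/-! ### Upper bounds for straight-line complexity -/

section StraightLine

variable {R V : Type*} [Ring R]

/-- Once all functions in `A` have been computed, all functions in `T` can be computed with `t`
further operations. -/
def Extends (ins : Set (V → R)) (t : ℕ) (A T : Set (V → R)) : Prop :=
  ∀ s S, StraightLine ins s S → A ⊆ S → ∃ S', S ⊆ S' ∧ T ⊆ S' ∧ StraightLine ins (s + t) S'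

variable {ins : Set (V → R)}

theorem StraightLine.const_mem {t : ℕ} {S : Set (V → R)} (h : StraightLine ins t S) (c : R) :
    (fun _ => c) ∈ S := by
  induction h with
  | start => exact Or.inr ⟨c, rfl⟩
  | add _ _ _ ih => exact Or.inr ih
  | sub _ _ _ ih => exact Or.inr ih
  | mul _ _ _ ih => exact Or.inr ih

theorem Extends.of_subset {A T : Set (V → R)} (h : T ⊆ A) : Extends ins 0 A T :=
  fun _ S hS hA => ⟨S, subset_rfl, h.trans hA, hS⟩

theorem Extends.trans {A B T : Set (V → R)} {s t : ℕ} (h : Extends ins s A B)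
    (h' : Extends ins t B T) : Extends ins (s + t) A T := by
  intro r S hS hA
  obtain ⟨S₁, h₁, hB, hS₁⟩ := h r S hS hA
  obtain ⟨S₂, h₂, hT, hS₂⟩ := h' _ S₁ hS₁ hB
  exact ⟨S₂, h₁.trans h₂, hT, by rwa [← add_assoc]⟩

theorem Extends.union {A T T' : Set (V → R)} {s t : ℕ} (h : Extends ins s A T)
    (h' : Extends ins t A T') : Extends ins (s + t) A (T ∪ T') := by
  intro r S hS hA
  obtain ⟨S₁, h₁, hT, hS₁⟩ := h r S hS hA
  obtain ⟨S₂, h₂, hT', hS₂⟩ := h' _ S₁ hS₁ (hA.trans h₁)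
  exact ⟨S₂, h₁.trans h₂, Set.union_subset (hT.trans h₂) hT', by rwa [← add_assoc]⟩

theorem Extends.mono {A B T T' : Set (V → R)} {t : ℕ} (h : Extends ins t A T) (hA : A ⊆ B)
    (hT : T' ⊆ T) : Extends ins t B T' := by
  intro r S hS hB
  obtain ⟨S₁, h₁, hT₁, hS₁⟩ := h r S hS (hA.trans hB)
  exact ⟨S₁, h₁, hT.trans hT₁, hS₁⟩

theorem Extends.iUnion_range {A : Set (V → R)} {t : ℕ} (n : ℕ) (T : ℕ → Set (V → R))
    (h : ∀ i < n, Extends ins t A (T i)) : Extends ins (n * t) A (⋃ i, ⋃ (_ : i < n), T i) := by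
  induction n with
  | zero => rw [zero_mul]; exact .of_subset (by simp)
  | succ n ih =>
    have := (ih fun i hi => h i (by omega)).union (h n (by omega))
    rw [Nat.succ_mul]
    refine this.mono subset_rfl ?_
    refine Set.iUnion₂_subset fun i hi => ?_
    rcases Nat.lt_succ_iff_lt_or_eq.mp hi with hi | rfl
    · exact Set.subset_union_of_subset_left
        (Set.subset_iUnion₂ (s := fun i (_ : i < n) => T i) i hi) _
    · exact Set.subset_union_right

theorem Extends.const_mul (c : R) (f : V → R) : Extends ins 1 {f} {fun v => c * f v} := by
  intro s S hS hf
  exact ⟨_, Set.subset_insert _ _, Set.singleton_subset_iff.mpr (Set.mem_insert _ _),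
    hS.mul (hS.const_mem c) (hf rfl)⟩

theorem Extends.add (f g : V → R) : Extends ins 1 {f, g} {f + g} := by
  intro s S hS hf
  exact ⟨_, Set.subset_insert _ _, Set.singleton_subset_iff.mpr (Set.mem_insert _ _),
    hS.add (hf (by simp)) (hf (by simp))⟩

theorem Extends.const (c : R) (A : Set (V → R)) : Extends ins 0 A {fun _ => c} := by
  intro s S hS hf
  exact ⟨S, subset_rfl, Set.singleton_subset_iff.mpr (hS.const_mem c), hS⟩

/-- A linear combination of `n` functions takes at most `2 n` operations. -/
theorem Extends.linearCombination {A : Set (V → R)} (n : ℕ) (c : ℕ → R) (f : ℕ → V → R)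
    (hf : ∀ i < n, f i ∈ A) :
    Extends ins (n * 2) A {fun v => ∑ i ∈ Finset.range n, c i * f i v} := by
  induction n with
  | zero => simpa using Extends.const (ins := ins) 0 A
  | succ n ih =>
    have h₁ := ih fun i hi => hf i (by omega)
    have h₂ : Extends ins 1 A {fun v => c n * f n v} :=
      (Extends.const_mul (c n) (f n)).mono (Set.singleton_subset_iff.mpr (hf n (by omega)))
        subset_rfl
    have h₃ := (h₁.union h₂).trans ((Extends.add _ _).mono (T' := {fun v =>
      ∑ i ∈ Finset.range (n + 1), c i * f i v}) (by
        rw [Set.union_singleton]) (by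
        rw [Set.singleton_subset_iff, Set.mem_singleton_iff]
        funext v
        simp [Finset.sum_range_succ, add_comm]))
    rw [Nat.succ_mul]
    exact h₃

theorem complexity_le_of_extends {R ι κ : Type*} [Ring R] {F : (ι → R) → κ → R} {t : ℕ}
    (h : Extends (Set.range fun (i : ι) (v : ι → R) => v i) t
      (Set.range fun (i : ι) (v : ι → R) => v i) (Set.range fun j v => F v j)) :
    complexity F ≤ t := by
  obtain ⟨S, -, hT, hS⟩ := h 0 _ .start Set.subset_union_left
  exact Nat.sInf_le ⟨S, by simpa using hS, fun j => hT ⟨j, rfl⟩⟩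

/-- The complexity of a linear map is at most twice the number of entries of its matrix. -/
theorem complexity_linear_le {R : Type*} [Ring R] {m n : ℕ} (c : Fin m → Fin n → R)
    (F : (Fin n → R) → Fin m → R) (hF : ∀ v j, F v j = ∑ i, c j i * v i) :
    complexity F ≤ m * (n * 2) := by
  apply complexity_le_of_extends
  refine (Extends.iUnion_range m (fun j => {fun v : Fin n → R => ∑ i ∈ Finset.range n,
    (if h : j < m ∧ i < n then c ⟨j, h.1⟩ ⟨i, h.2⟩ else 0) *
      (if h : i < n then v ⟨i, h⟩ else 0)}) fun j hj => ?_).mono subset_rfl ?_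
  · exact Extends.linearCombination n
      (fun i => if h : j < m ∧ i < n then c ⟨j, h.1⟩ ⟨i, h.2⟩ else 0)
      (fun i (v : Fin n → R) => if h : i < n then v ⟨i, h⟩ else 0)
      fun i hi => ⟨⟨i, hi⟩, by simp [hi]⟩
  · rintro _ ⟨j, rfl⟩
    refine Set.mem_iUnion₂.mpr ⟨j, j.2, ?_⟩
    rw [Set.mem_singleton_iff]
    funext v
    refine (hF v j).trans ?_
    rw [Finset.sum_range]
    simp

/-- The fast Fourier transform of order `p ^ e`. -/
theorem Extends.fft {A : Type*} [CommRing A] {V : Type*} {ins : Set (V → A)} (p e : ℕ) (ω : A)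
    (hω : ω ^ p ^ e = 1) (a : ℕ → V → A) :
    Extends ins (e * p ^ e * (p * 2)) {f | ∃ ν < p ^ e, f = a ν}
      {f | ∃ i < p ^ e, f = fun v => ∑ ν ∈ Finset.range (p ^ e), ω ^ (i * ν) * a ν v} := by
  induction e generalizing ω a with
  | zero =>
    rw [zero_mul, zero_mul]
    apply Extends.of_subset
    rintro _ ⟨i, hi, rfl⟩
    refine ⟨0, by simp, ?_⟩
    funext v
    obtain rfl : i = 0 := by simpa using hi
    simp
  | succ e ih =>
    set q := p ^ e with hq
    -- Inputs are indexed by q·s + μ and outputs by i = p·m + l. The twiddle factors are absorbed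
    -- into the coefficients of these linear combinations and cost nothing extra.
    set b : ℕ → ℕ → V → A := fun l μ v =>
      ∑ s ∈ Finset.range p, ω ^ (l * (q * s + μ)) * a (q * s + μ) v with hb
    have hpq : p ^ (e + 1) = p * q := by rw [pow_succ', hq]
    have h₁ : Extends ins (p * (q * (p * 2))) {f | ∃ ν < p ^ (e + 1), f = a ν}
        (⋃ l, ⋃ (_ : l < p), ⋃ μ, ⋃ (_ : μ < q), {b l μ}) := by
      refine Extends.iUnion_range p _ fun l hl => Extends.iUnion_range q _ fun μ hμ => ?_
      refine Extends.linearCombination p _ (fun s => a (q * s + μ)) fun s hs =>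
        ⟨_, ?_, rfl⟩
      rw [hpq]
      nlinarith
    have h₂ : Extends ins (p * (e * q * (p * 2)))
        (⋃ l, ⋃ (_ : l < p), ⋃ μ, ⋃ (_ : μ < q), {b l μ})
        (⋃ l, ⋃ (_ : l < p), {f | ∃ m < q, f = fun v =>
          ∑ μ ∈ Finset.range q, (ω ^ p) ^ (m * μ) * b l μ v}) := by
      refine Extends.iUnion_range p _ fun l hl => ?_
      refine (ih (ω ^ p) (by rw [← pow_mul, ← hpq, hω]) (b l)).mono ?_ subset_rfl
      rintro _ ⟨μ, hμ, rfl⟩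
      simp only [Set.mem_iUnion]
      exact ⟨l, hl, μ, hμ, rfl⟩
    have h₃ := h₁.trans h₂
    have ht : (e + 1) * p ^ (e + 1) * (p * 2) = p * (q * (p * 2)) + p * (e * q * (p * 2)) := by
      rw [hpq]; ring
    rw [ht]
    refine h₃.mono subset_rfl ?_
    rintro _ ⟨i, hi, rfl⟩
    have hp : 0 < p := by
      rcases Nat.eq_zero_or_pos p with rfl | h
      · simp at hi
      · exact h
    refine Set.mem_iUnion₂.mpr ⟨i % p, Nat.mod_lt _ hp, i / p, ?_, ?_⟩
    · rw [hpq] at hi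
      exact Nat.div_lt_of_lt_mul hi
    · funext v
      simp only [hb, Finset.mul_sum]
      rw [hpq, Finset.sum_comm, mul_comm p q]
      have := Finset.sum_product' (Finset.range p) (Finset.range q) (fun s μ =>
        (ω ^ p) ^ (i / p * μ) * (ω ^ (i % p * (q * s + μ)) * a (q * s + μ) v))
      rw [← this]
      symm
      refine Finset.sum_bij (fun x _ => q * x.1 + x.2) ?_ ?_ ?_ ?_
      · rintro ⟨s, μ⟩ h
        simp only [Finset.mem_product, Finset.mem_range] at h ⊢
        nlinarith
      · rintro ⟨s, μ⟩ h ⟨s', μ'⟩ h' heq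
        simp only [Finset.mem_product, Finset.mem_range] at h h' heq
        have h1 : (q * s + μ) / q = s := by
          rw [Nat.mul_add_div (by omega), Nat.div_eq_of_lt h.2, add_zero]
        have h2 : (q * s' + μ') / q = s' := by
          rw [Nat.mul_add_div (by omega), Nat.div_eq_of_lt h'.2, add_zero]
        have h3 : s = s' := by rw [← h1, heq, h2]
        subst h3
        simpa using heq
      · intro ν hν
        rw [Finset.mem_range] at hν
        have hq0 : 0 < q := Nat.pos_of_mul_pos_right (by omega : 0 < q * p)
        refine ⟨(ν / q, ν % q), ?_, Nat.div_add_mod _ _⟩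
        simp only [Finset.mem_product, Finset.mem_range]
        exact ⟨Nat.div_lt_of_lt_mul hν, Nat.mod_lt _ hq0⟩
      · rintro ⟨s, μ⟩ -
        dsimp only
        rw [← mul_assoc, ← pow_mul, ← pow_add]
        congr 1
        -- Modulo p^(e+1) = p·q the term with both ⌊i/p⌋ and s disappears from the exponent.
        have hsplit : i * (q * s + μ) =
            p ^ (e + 1) * (i / p * s) + (p * (i / p * μ) + i % p * (q * s + μ)) := by
          conv_lhs => rw [← Nat.div_add_mod i p]
          rw [hpq]; ring
        rw [hsplit, pow_add ω (p ^ (e + 1) * _), pow_mul ω (p ^ (e + 1)), hω, one_pow, one_mul]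

theorem complexity_dft_le {A : Type*} [CommRing A] (p e : ℕ) (ω : A) (hω : ω ^ p ^ e = 1) :
    complexity (dft ω (p ^ e)) ≤ e * p ^ e * (p * 2) := by
  apply complexity_le_of_extends
  refine (Extends.fft p e ω hω fun ν v => if h : ν < p ^ e then v ⟨ν, h⟩ else 0).mono ?_ ?_
  · rintro _ ⟨ν, hν, rfl⟩
    exact ⟨⟨ν, hν⟩, by simp [hν]⟩
  · rintro _ ⟨i, rfl⟩
    refine ⟨i, i.2, ?_⟩
    funext v
    change ∑ ν : Fin (p ^ e), ω ^ ((i : ℕ) * (ν : ℕ)) * v ν = _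
    rw [Finset.sum_range]
    simp

end StraightLine

/-! ### Multiplication by a fixed element modulo P. -/

section ScaleCost

variable {k : Type u} [Field k]

/-- The map is linear, with the residues of w·X^i as columns. What matters is that the bound does
not depend on w. -/
theorem scaleCost_le (P w : k[X]) : scaleCost P w ≤ P.natDegree * (P.natDegree * 2) := by
  refine complexity_linear_le (fun j i => ((w * X ^ (i : ℕ)) %ₘ P).coeff j) _ fun v j => ?_
  have : ((w * ofCoeffs v) %ₘ P) = ∑ i, v i • ((w * X ^ (i : ℕ)) %ₘ P) := by
    change modByMonicHom P (w * ofCoeffs v) = ∑ i, v i • modByMonicHom P (w * X ^ (i : ℕ))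
    simp_rw [← map_smul, ← map_sum]
    congr 1
    rw [ofCoeffs, Finset.mul_sum]
    refine Finset.sum_congr rfl fun i _ => ?_
    rw [smul_eq_C_mul]
    ring
  rw [this, finsetSum_coeff]
  refine Finset.sum_congr rfl fun i _ => ?_
  rw [coeff_smul, smul_eq_mul, mul_comm]

end ScaleCost

/-! ### Radical extensions of prime degree -/

section Radical

open IntermediateField

variable {F L : Type*} [Field F] [Field L] [Algebra F L] {p : ℕ} {x : F} {z : L}

theorem minpoly_eq_X_pow_sub_C (hp : p.Prime) (hz : z ^ p = algebraMap F L x)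
    (hx : ∀ b : F, b ^ p ≠ x) : minpoly F z = X ^ p - C x :=
  (minpoly.eq_of_irreducible_of_monic (X_pow_sub_C_irreducible_of_prime hp hx)
    (by simp [hz]) (monic_X_pow_sub_C x hp.ne_zero)).symm

theorem isIntegral_of_pow_eq (hp : p.Prime) (hz : z ^ p = algebraMap F L x) : IsIntegral F z :=
  ⟨X ^ p - C x, monic_X_pow_sub_C x hp.ne_zero, by simp [hz]⟩

theorem finrank_adjoin_of_forall_pow_ne (hp : p.Prime) (hz : z ^ p = algebraMap F L x)
    (hx : ∀ b : F, b ^ p ≠ x) : Module.finrank F F⟮z⟯ = p := by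
  rw [adjoin.finrank (isIntegral_of_pow_eq hp hz), minpoly_eq_X_pow_sub_C hp hz hx,
    natDegree_X_pow_sub_C]

/-- If `x` is not a `p`-th power in `F`, then its `p`-th root `z` is not a `p`-th power in
`F(z)`. -/
theorem pow_ne_gen (hp : p.Prime) (hz : z ^ p = algebraMap F L x) (hx : ∀ b : F, b ^ p ≠ x)
    (h2 : p = 2 → ∃ i : F, i ^ 2 = -1) (b : F⟮z⟯) : (b : L) ^ p ≠ z := by
  intro hb
  have hint := isIntegral_of_pow_eq hp hz
  have hb' : b ^ p = AdjoinSimple.gen F z := by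
    apply Subtype.ext
    simpa using hb
  -- If b^p = z, then N(b)^p = N(z) = ±x. The sign is + for odd p. For p = 2 it is -, and is
  -- repaired by the square root of -1, so x would be a p-th power.
  have hN : Algebra.norm F (AdjoinSimple.gen F z) = (-1) ^ p * -x := by
    have := Algebra.PowerBasis.norm_gen_eq_coeff_zero_minpoly (adjoin.powerBasis hint)
    rw [adjoin.powerBasis_gen, adjoin.powerBasis_dim, minpoly_gen,
      minpoly_eq_X_pow_sub_C hp hz hx, natDegree_X_pow_sub_C] at this
    rw [this]
    simp [hp.ne_zero.symm]
  rw [← hb', map_pow] at hN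
  rcases hp.eq_two_or_odd' with rfl | hodd
  · obtain ⟨i, hi⟩ := h2 rfl
    refine hx (i * Algebra.norm F b) ?_
    rw [mul_pow, hN, hi]
    ring
  · refine hx _ (hN.trans ?_)
    rw [hodd.neg_one_pow]
    ring

end Radical

/-! ### The degree function -/

section DegreeFunction

open IntermediateField

variable {k : Type u} [Field k]

theorem degreeFunction_eq {n : ℕ} (hn : n ≠ 0) {z : AlgebraicClosure k} (hz : IsPrimitiveRoot z n) :
    degreeFunction k n = Module.finrank k k⟮z⟯ := by
  have : adjoin k {ω : AlgebraicClosure k | IsPrimitiveRoot ω n} = k⟮z⟯ := by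
    apply le_antisymm
    · rw [adjoin_le_iff]
      intro w hw
      have : NeZero n := ⟨hn⟩
      obtain ⟨i, -, rfl⟩ := hz.eq_pow_of_pow_eq_one (IsPrimitiveRoot.pow_eq_one hw)
      exact pow_mem (mem_adjoin_simple_self k z) i
    · exact adjoin.mono _ _ _ (Set.singleton_subset_iff.mpr hz)
  rw [degreeFunction, this]

theorem exists_isPrimitiveRoot_of_ne_zero {n : ℕ} (hn : (n : k) ≠ 0) :
    ∃ z : AlgebraicClosure k, IsPrimitiveRoot z n := by
  have : NeZero (n : k) := ⟨hn⟩
  exact HasEnoughRootsOfUnity.exists_primitiveRoot (AlgebraicClosure k) n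

theorem finiteDimensional_adjoin_simple (z : AlgebraicClosure k) : FiniteDimensional k k⟮z⟯ :=
  adjoin.finiteDimensional (Algebra.IsIntegral.isIntegral z)

theorem finrank_adjoin_mul {x z : AlgebraicClosure k} (hx : x ∈ k⟮z⟯) :
    Module.finrank k k⟮z⟯ = Module.finrank k k⟮x⟯ * Module.finrank k⟮x⟯ k⟮x⟯⟮z⟯ := by
  have : k⟮z⟯ = k⟮x⟯⟮z⟯.restrictScalars k := by
    rw [adjoin_simple_adjoin_simple]
    apply le_antisymm
    · exact adjoin.mono _ _ _ (by simp)
    · rw [adjoin_le_iff, Set.insert_subset_iff, Set.singleton_subset_iff]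
      exact ⟨hx, mem_adjoin_simple_self k z⟩
  rw [Module.finrank_mul_finrank, this]
  rfl

theorem degreeFunction_pos {n : ℕ} (hn : (n : k) ≠ 0) : 0 < degreeFunction k n := by
  obtain ⟨z, hz⟩ := exists_isPrimitiveRoot_of_ne_zero hn
  rw [degreeFunction_eq (by rintro rfl; simp at hn) hz]
  have := finiteDimensional_adjoin_simple z
  exact Module.finrank_pos

theorem degreeFunction_dvd {m n : ℕ} (h : m ∣ n) (hn : (n : k) ≠ 0) :
    degreeFunction k m ∣ degreeFunction k n := by
  have hn0 : n ≠ 0 := by rintro rfl; simp at hn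
  obtain ⟨z, hz⟩ := exists_isPrimitiveRoot_of_ne_zero hn
  obtain ⟨d, rfl⟩ := h
  have hd : IsPrimitiveRoot (z ^ d) m := hz.pow (Nat.pos_of_ne_zero hn0) (mul_comm m d)
  rw [degreeFunction_eq hn0 hz, degreeFunction_eq (left_ne_zero_of_mul hn0) hd,
    finrank_adjoin_mul (pow_mem (mem_adjoin_simple_self k z) d)]
  exact dvd_mul_right _ _

/-- A principal root of unity in a finite-dimensional algebra bounds the degree function. -/
theorem IsPrincipalRoot.exists_isPrimitiveRoot {A : Type*} [Ring A] [Nontrivial A] [Algebra k A]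
    [Module.Finite k A] {ω : A} {n : ℕ} (hn : 0 < n) (h : IsPrincipalRoot ω n) :
    ∃ z : AlgebraicClosure k, IsPrimitiveRoot z n ∧
      (minpoly k z).natDegree ≤ Module.finrank k A := by
  have hint : IsIntegral k ω := Algebra.IsIntegral.isIntegral ω
  have hμ : 0 < (minpoly k ω).natDegree := minpoly.natDegree_pos hint
  obtain ⟨z, hz⟩ := IsAlgClosed.exists_aeval_eq_zero (AlgebraicClosure k) (minpoly k ω)
    (natDegree_pos_iff_degree_pos.mp hμ).ne'
  obtain ⟨q, hq⟩ := minpoly.dvd k z hz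
  have hμ0 := minpoly.ne_zero hint
  have hq0 : q ≠ 0 := by rintro rfl; simp [hq] at hμ0
  have hzint : IsIntegral k z := Algebra.IsIntegral.isIntegral z
  have hdeg : (minpoly k ω).natDegree = (minpoly k z).natDegree + q.natDegree := by
    rw [hq, natDegree_mul (minpoly.ne_zero hzint) hq0]
  refine ⟨z, IsPrimitiveRoot.mk_of_lt z hn ?_ ?_, ?_⟩
  · have : minpoly k ω ∣ X ^ n - 1 := minpoly.dvd k ω (by simp [h.1])
    have := aeval_eq_zero_of_dvd_aeval_eq_zero this hz
    simpa [sub_eq_zero] using this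
  · intro ν hν hνn h1
    obtain ⟨r, hr⟩ : minpoly k z ∣ X ^ ν - 1 := minpoly.dvd k z (by simp [h1])
    -- With minpoly(ω) = minpoly(z)·q and minpoly(z) dividing X^ν - 1, the element (1 - ω^ν)·q(ω)
    -- vanishes. As 1 - ω^ν is no zero divisor, q(ω) = 0, against the minimality of minpoly(ω).
    have hmul : (1 - ω ^ ν) * aeval ω q = 0 := by
      have : (1 - ω ^ ν) * aeval ω q = aeval ω (-(minpoly k ω * r)) := by
        have : (1 - ω ^ ν) = aeval ω (-(X ^ ν - 1 : k[X])) := by simp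
        rw [this, ← map_mul]
        congr 1
        rw [hr, hq]
        ring
      rw [this]
      simp
    have hq1 := (mem_nonZeroDivisors_iff.mp (h.2 ν hν hνn)).1 _ hmul
    have := natDegree_le_of_dvd (minpoly.dvd k ω hq1) hq0
    have := minpoly.natDegree_pos hzint
    omega
  · have := minpoly.natDegree_le (A := k) ω
    omega

theorem IsPrincipalRoot.natCast_ne_zero {A : Type*} [Ring A] [Nontrivial A] [Algebra k A]
    [Module.Finite k A] {ω : A} {n : ℕ} (hn : 0 < n) (h : IsPrincipalRoot ω n) : (n : k) ≠ 0 := by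
  obtain ⟨z, hz, -⟩ := h.exists_isPrimitiveRoot (k := k) hn
  have : NeZero n := ⟨hn.ne'⟩
  intro h0
  apply hz.neZero'.ne
  rw [← map_natCast (algebraMap k (AlgebraicClosure k)), h0, map_zero]

theorem IsPrincipalRoot.degreeFunction_le {A : Type*} [Ring A] [Nontrivial A] [Algebra k A]
    [Module.Finite k A] {ω : A} {n : ℕ} (hn : 0 < n) (h : IsPrincipalRoot ω n) :
    degreeFunction k n ≤ Module.finrank k A := by
  obtain ⟨z, hz, hle⟩ := h.exists_isPrimitiveRoot (k := k) hn
  rwa [degreeFunction_eq hn.ne' hz, adjoin.finrank (Algebra.IsIntegral.isIntegral z)]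

/-! ### Towers of cyclotomic extensions of prime power order -/

theorem degreeFunction_pow_succ_of_forall_ne {p e : ℕ} (hp : p.Prime) {z : AlgebraicClosure k}
    (hz : IsPrimitiveRoot z (p ^ (e + 1))) (h : ∀ b : k⟮z ^ p⟯, (b : AlgebraicClosure k) ^ p ≠ z ^ p) :
    degreeFunction k (p ^ (e + 1)) = degreeFunction k (p ^ e) * p := by
  have hx : IsPrimitiveRoot (z ^ p) (p ^ e) := hz.pow (by have := hp.pos; positivity) (pow_succ' p e)
  rw [degreeFunction_eq (pow_ne_zero _ hp.ne_zero) hz,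
    degreeFunction_eq (pow_ne_zero _ hp.ne_zero) hx,
    finrank_adjoin_mul (pow_mem (mem_adjoin_simple_self k z) p)]
  congr 1
  refine finrank_adjoin_of_forall_pow_ne hp (x := AdjoinSimple.gen k (z ^ p)) rfl fun b hb => h b ?_
  simpa using congrArg Subtype.val hb

/-- The quotient z/b is a p-th root of unity, hence a power of z^(p^e). For e ≥ 1 this lies in
k(z^p), so z does too. -/
theorem degreeFunction_pow_succ_of_exists {p e : ℕ} (hp : p.Prime) (he : 1 ≤ e)
    {z : AlgebraicClosure k} (hz : IsPrimitiveRoot z (p ^ (e + 1))) (b : k⟮z ^ p⟯)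
    (h : (b : AlgebraicClosure k) ^ p = z ^ p) :
    degreeFunction k (p ^ (e + 1)) = degreeFunction k (p ^ e) := by
  have hpos : 0 < p ^ (e + 1) := by have := hp.pos; positivity
  have hx : IsPrimitiveRoot (z ^ p) (p ^ e) := hz.pow hpos (pow_succ' p e)
  have hu : IsPrimitiveRoot (z ^ p ^ e) p := hz.pow hpos (pow_succ p e)
  have hz0 : z ≠ 0 := hz.ne_zero hpos.ne'
  have hb0 : (b : AlgebraicClosure k) ≠ 0 := by
    intro h0
    rw [h0, zero_pow hp.ne_zero] at h
    exact pow_ne_zero p hz0 h.symm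
  have : NeZero p := ⟨hp.ne_zero⟩
  obtain ⟨i, -, hi⟩ := hu.eq_pow_of_pow_eq_one (ξ := z / b) (by
    rw [div_pow, h, div_self (pow_ne_zero p hz0)])
  have hzmem : z ∈ k⟮z ^ p⟯ := by
    have h1 : z = (z ^ p ^ e) ^ i * b := by rw [hi, div_mul_cancel₀ z hb0]
    have h2 : z ^ p ^ e = (z ^ p) ^ p ^ (e - 1) := by
      rw [← pow_mul, ← pow_succ', Nat.sub_add_cancel he]
    have hmem : ((z ^ p) ^ p ^ (e - 1)) ^ i * b ∈ k⟮z ^ p⟯ :=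
      mul_mem (pow_mem (pow_mem (mem_adjoin_simple_self k _) _) _) b.2
    rwa [← h2, ← h1] at hmem
  rw [degreeFunction_eq hpos.ne' hz, degreeFunction_eq (pow_ne_zero _ hp.ne_zero) hx]
  have : k⟮z⟯ = k⟮z ^ p⟯ := le_antisymm (adjoin_simple_le_iff.mpr hzmem)
    (adjoin_simple_le_iff.mpr (pow_mem (mem_adjoin_simple_self k z) p))
  rw [this]

variable {p : ℕ}

theorem degreeFunction_pow_succ (hp : p.Prime) (hpk : (p : k) ≠ 0) {e : ℕ} (he : 1 ≤ e) :
    degreeFunction k (p ^ (e + 1)) = degreeFunction k (p ^ e) ∨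
      degreeFunction k (p ^ (e + 1)) = degreeFunction k (p ^ e) * p := by
  obtain ⟨z, hz⟩ := exists_isPrimitiveRoot_of_ne_zero (k := k) (n := p ^ (e + 1))
    (by push_cast; exact pow_ne_zero _ hpk)
  by_cases h : ∃ b : k⟮z ^ p⟯, (b : AlgebraicClosure k) ^ p = z ^ p
  · obtain ⟨b, hb⟩ := h
    exact Or.inl (degreeFunction_pow_succ_of_exists hp he hz b hb)
  · exact Or.inr (degreeFunction_pow_succ_of_forall_ne hp hz (not_exists.mp h))

/-- A jump persists. With z of order p^(e+1), the jump says that z^p is no p-th power in k(z^p), and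
`pow_ne_gen` passes this on to z in k(z). The bound e ≥ 2 ensures that for p = 2 the base field
contains a square root of -1. -/
theorem degreeFunction_pow_add_two (hp : p.Prime) (hpk : (p : k) ≠ 0) {e : ℕ} (he : 2 ≤ e)
    (h : degreeFunction k (p ^ (e + 1)) = degreeFunction k (p ^ e) * p) :
    degreeFunction k (p ^ (e + 2)) = degreeFunction k (p ^ (e + 1)) * p := by
  have hpos : ∀ j, 0 < p ^ j := fun j => pow_pos hp.pos j
  obtain ⟨y, hy⟩ := exists_isPrimitiveRoot_of_ne_zero (k := k) (n := p ^ (e + 2))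
    (by push_cast; exact pow_ne_zero _ hpk)
  have hz : IsPrimitiveRoot (y ^ p) (p ^ (e + 1)) := hy.pow (hpos _) (pow_succ' p (e + 1))
  have hx : IsPrimitiveRoot ((y ^ p) ^ p) (p ^ e) := hz.pow (hpos _) (pow_succ' p e)
  refine degreeFunction_pow_succ_of_forall_ne hp hy fun b hb => ?_
  have hne : ∀ b : k⟮(y ^ p) ^ p⟯, (b : AlgebraicClosure k) ^ p ≠ (y ^ p) ^ p := by
    intro b hb
    rw [degreeFunction_pow_succ_of_exists hp (by omega) hz b hb] at h
    have h0 := degreeFunction_pos (k := k) (n := p ^ e) (by push_cast; exact pow_ne_zero _ hpk)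
    have := hp.two_le
    nlinarith
  have hbmem : (b : AlgebraicClosure k) ∈ k⟮(y ^ p) ^ p⟯⟮y ^ p⟯ := by
    have : k⟮y ^ p⟯ ≤ k⟮(y ^ p) ^ p⟯⟮y ^ p⟯.restrictScalars k := by
      rw [adjoin_simple_le_iff]
      exact mem_adjoin_simple_self _ (y ^ p)
    exact this b.2
  refine pow_ne_gen hp (F := k⟮(y ^ p) ^ p⟯) (L := AlgebraicClosure k) (z := y ^ p)
    (x := AdjoinSimple.gen k ((y ^ p) ^ p)) rfl (fun c hc => hne c ?_) ?_ ⟨b, hbmem⟩ hb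
  · simpa using congrArg Subtype.val hc
  · rintro rfl
    -- The generator has order 2^e, so this power has order 4 and its square is -1.
    refine ⟨AdjoinSimple.gen k _ ^ 2 ^ (e - 2), ?_⟩
    apply Subtype.ext
    have h2 : IsPrimitiveRoot (((y ^ 2) ^ 2) ^ 2 ^ (e - 1)) 2 :=
      hx.pow (hpos _) (by rw [← pow_succ, Nat.sub_add_cancel (by omega)])
    have h3 := h2.eq_neg_one_of_two_right
    have h4 (g : k⟮(y ^ 2) ^ 2⟯) : (g ^ 2 ^ (e - 2)) ^ 2 = g ^ 2 ^ (e - 1) := by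
      rw [← pow_mul g, ← pow_succ 2, show e - 2 + 1 = e - 1 by omega]
    rw [h4]
    simpa using h3

/-- Either some jump occurs at an exponent e ≥ 2 and then never stops, or the degree is constant
from p^2 on. -/
theorem degreeFunction_bounded_or (hp : p.Prime) (hpk : (p : k) ≠ 0) :
    (∃ C, ∀ e, degreeFunction k (p ^ e) ≤ C) ∨
      ∃ e₀, ∀ j, p ^ j ∣ degreeFunction k (p ^ (e₀ + j)) := by
  by_cases h : ∃ e, 2 ≤ e ∧ degreeFunction k (p ^ (e + 1)) = degreeFunction k (p ^ e) * p
  · right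
    obtain ⟨e, he, h⟩ := h
    have hstep : ∀ j, degreeFunction k (p ^ (e + j + 1)) = degreeFunction k (p ^ (e + j)) * p := by
      intro j
      induction j with
      | zero => exact h
      | succ j ih => exact degreeFunction_pow_add_two hp hpk (e := e + j) (by omega) ih
    refine ⟨e, fun j => ?_⟩
    induction j with
    | zero => simp
    | succ j ih =>
      rw [← add_assoc, hstep, pow_succ]
      exact mul_dvd_mul_right ih p
  · left
    push Not at h
    have hconst : ∀ j, degreeFunction k (p ^ (2 + j)) = degreeFunction k (p ^ 2) := by
      intro j
      induction j with
      | zero => rfl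
      | succ j ih =>
        rw [← add_assoc]
        exact ((degreeFunction_pow_succ hp hpk (by omega)).resolve_right (h _ (by omega))).trans ih
    refine ⟨degreeFunction k (p ^ 2), fun e => ?_⟩
    have hne : ∀ e, ((p ^ e : ℕ) : k) ≠ 0 := fun e => by push_cast; exact pow_ne_zero _ hpk
    rw [← hconst e]
    exact Nat.le_of_dvd (degreeFunction_pos (hne _))
      (degreeFunction_dvd (pow_dvd_pow p (by omega)) (hne _))

/-- If the degree function is unbounded on the powers of each prime, then it grows linearly on the
integers with bounded prime factors. -/
theorem exists_le_mul_degreeFunction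
    (h : ∀ p : ℕ, p.Prime → (p : k) ≠ 0 → ¬ ∃ C, ∀ e, degreeFunction k (p ^ e) ≤ C) (Q : ℕ) :
    ∃ c : ℕ, ∀ n : ℕ, (n : k) ≠ 0 → (∀ p : ℕ, p.Prime → p ∣ n → p ≤ Q) →
      n ≤ c * degreeFunction k n := by
  have hex : ∀ p : ℕ, ∃ e₀, p.Prime → (p : k) ≠ 0 →
      ∀ j, p ^ j ∣ degreeFunction k (p ^ (e₀ + j)) := by
    intro p
    by_cases hp : p.Prime ∧ (p : k) ≠ 0
    · obtain ⟨e₀, he⟩ := (degreeFunction_bounded_or hp.1 hp.2).resolve_left (h p hp.1 hp.2)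
      exact ⟨e₀, fun _ _ => he⟩
    · exact ⟨0, fun h1 h2 => absurd ⟨h1, h2⟩ hp⟩
  choose e₀ he₀ using hex
  -- The constant pays for the first e₀ factors of each prime, before the jumps set in. Then n even
  -- divides c·f(n), which can be checked one prime power at a time.
  refine ⟨∏ q ∈ Finset.Icc 1 Q, q ^ e₀ q, fun n hn hQ => ?_⟩
  have hpos : 0 < ∏ q ∈ Finset.Icc 1 Q, q ^ e₀ q :=
    Finset.prod_pos fun q hq => pow_pos (Finset.mem_Icc.mp hq).1 _
  refine Nat.le_of_dvd (Nat.mul_pos hpos (degreeFunction_pos hn)) ?_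
  rw [Nat.dvd_iff_prime_pow_dvd_dvd]
  intro p j hp hj
  rcases Nat.eq_zero_or_pos j with rfl | hj0
  · simp
  have hpn : p ∣ n := (dvd_pow_self p hj0.ne').trans hj
  have hpk : (p : k) ≠ 0 := by
    obtain ⟨m, rfl⟩ := hpn
    rw [Nat.cast_mul] at hn
    exact left_ne_zero_of_mul hn
  have h1 : p ^ e₀ p ∣ ∏ q ∈ Finset.Icc 1 Q, q ^ e₀ q :=
    Finset.dvd_prod_of_mem _ (Finset.mem_Icc.mpr ⟨hp.pos, hQ p hp hpn⟩)
  rcases le_total j (e₀ p) with hle | hle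
  · exact ((pow_dvd_pow p hle).trans h1).mul_right _
  · obtain ⟨i, rfl⟩ := Nat.exists_eq_add_of_le hle
    rw [pow_add]
    exact mul_dvd_mul h1 ((he₀ p hp hpk i).trans (degreeFunction_dvd hj hn))

end DegreeFunction

/-! ### Order sequences -/

section OrderSequence

variable {k : Type u} [Field k]

theorem OrderSequence.elt_pos (𝒩 : OrderSequence k) (i : ℕ) : 0 < 𝒩.elt i := by
  cases i with
  | zero =>
    refine Nat.pos_of_ne_zero fun h => ?_
    have h1 := 𝒩.dvd 0
    have h2 := 𝒩.lt 0
    rw [OrderSequence.elt] at h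
    rw [h, zero_dvd_iff] at h1
    omega
  | succ i => exact Nat.zero_lt_of_lt (𝒩.lt i)

theorem OrderSequence.fst_pos (𝒩 : OrderSequence k) (i : ℕ) : 0 < 𝒩.fst i :=
  Nat.pos_of_mul_pos_right (𝒩.elt_pos i)

theorem OrderSequence.snd_pos (𝒩 : OrderSequence k) (i : ℕ) : 0 < 𝒩.snd i :=
  Nat.pos_of_mul_pos_left (𝒩.elt_pos i)

theorem OrderSequence.le_elt (𝒩 : OrderSequence k) (i : ℕ) : i ≤ 𝒩.elt i :=
  (strictMono_nat_of_lt_succ (f := 𝒩.elt) 𝒩.lt).le_apply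

theorem OrderSequence.natCast_snd_ne_zero (𝒩 : OrderSequence k) (i : ℕ) : (𝒩.snd i : k) ≠ 0 := by
  obtain ⟨c, h⟩ := 𝒩.ext
  obtain ⟨A, _, _, hA, ω, hω, -⟩ := h i
  have hpos : 0 < Module.finrank k A := hA ▸ 𝒩.fst_pos i
  have := Module.finite_of_finrank_pos hpos
  have := Module.nontrivial_of_finrank_pos hpos
  exact hω.natCast_ne_zero (𝒩.snd_pos i)

theorem OrderSequence.degreeFunction_snd_le (𝒩 : OrderSequence k) (i : ℕ) :
    degreeFunction k (𝒩.snd i) ≤ 𝒩.fst i := by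
  obtain ⟨c, h⟩ := 𝒩.ext
  obtain ⟨A, _, _, hA, ω, hω, -⟩ := h i
  have hpos : 0 < Module.finrank k A := hA ▸ 𝒩.fst_pos i
  have := Module.finite_of_finrank_pos hpos
  have := Module.nontrivial_of_finrank_pos hpos
  exact hA ▸ hω.degreeFunction_le (𝒩.snd_pos i)

/-- Each quotient n_{i+1}/n_i is an integer at most C, so every prime factor divides n_0 or is at
most C. -/
theorem OrderSequence.ConstantSparseness.exists_prime_le {𝒩 : OrderSequence k}
    (h : 𝒩.ConstantSparseness) : ∃ Q, ∀ i p, p.Prime → p ∣ 𝒩.elt i → p ≤ Q := by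
  obtain ⟨s, C, ⟨-, hs⟩, hC⟩ := h
  refine ⟨max (𝒩.elt 0) ⌈C⌉₊, fun i p hp hdvd => ?_⟩
  induction i with
  | zero => exact le_max_of_le_left (Nat.le_of_dvd (𝒩.elt_pos 0) hdvd)
  | succ i ih =>
    obtain ⟨r, hr⟩ : 𝒩.elt i ∣ 𝒩.elt (i + 1) := 𝒩.dvd i
    have hi : (0 : ℝ) < 𝒩.elt i := by exact_mod_cast 𝒩.elt_pos i
    have hr0 : 0 < r := by
      have := 𝒩.elt_pos (i + 1)
      rw [hr] at this
      exact Nat.pos_of_mul_pos_left this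
    have hrC : (r : ℝ) ≤ C := by
      have h1 := (hs i).trans (mul_le_mul_of_nonneg_right (hC _) hi.le)
      rw [hr, Nat.cast_mul, mul_comm C] at h1
      exact le_of_mul_le_mul_left h1 hi
    rw [hr] at hdvd
    rcases hp.dvd_mul.mp hdvd with hd | hd
    · exact ih hd
    · exact le_max_of_le_right ((Nat.le_of_dvd hr0 hd).trans
        (by exact_mod_cast hrC.trans (Nat.le_ceil C)))

/-- A sequence of powers of a prime, with trivial roots of unity. -/
noncomputable def OrderSequence.primePow (k : Type u) [Field k] {p : ℕ} (hp : p.Prime) :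
    OrderSequence k where
  fst i := p ^ i
  snd _ := 1
  lt i := by simpa using Nat.pow_lt_pow_right hp.one_lt (Nat.lt_succ_self i)
  dvd i := by simpa using pow_dvd_pow p (Nat.le_succ i)
  ext := by
    refine ⟨0, fun i => ⟨Fin (p ^ i) → k, inferInstance, inferInstance, by simp, 1, ⟨by simp, ?_⟩, ?_⟩⟩
    · intro ν h1 h2
      omega
    -- Since log 1 = 0, suitability of the order 1 demands a DFT of cost zero.
    · have h : complexity (dft (1 : Fin (p ^ i) → k) 1) ≤ 0 * p ^ 0 * (p * 2) :=
        complexity_dft_le p 0 1 (by simp)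
      simp only [zero_mul, Nat.le_zero] at h
      simp [h]

theorem OrderSequence.primePow_constantSparseness {p : ℕ} (hp : p.Prime) :
    (OrderSequence.primePow k hp).ConstantSparseness := by
  have h2 : (1 : ℝ) < p := by exact_mod_cast hp.one_lt
  refine ⟨fun _ => p, p, ⟨fun _ => h2, fun i => ?_⟩, fun _ => le_rfl⟩
  simp [OrderSequence.elt, OrderSequence.primePow, pow_succ']

end OrderSequence

/-! ### Fast and slow fields -/

section FastSlow

variable {k : Type u} [Field k]

/-- Slowness speaks only of the values n_i'. The sequence with n_i'' = 1 turns it into a statement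
about all powers of p, where eventually t(n) ≥ c·n^(1/2). -/
theorem IsSlowWith.unbounded {t : ℕ → ℝ} (ht : IsOmegaNearlyLinear t) (h : IsSlowWith k t)
    {p : ℕ} (hp : p.Prime) (hpk : (p : k) ≠ 0) : ¬ ∃ C, ∀ e, degreeFunction k (p ^ e) ≤ C := by
  rintro ⟨C, hC⟩
  obtain ⟨ε, hε, c, hc, hct⟩ := ht
  have hpow : Tendsto (fun e : ℕ => p ^ e) atTop atTop := tendsto_pow_atTop_atTop_of_one_lt hp.one_lt
  have hlim : Tendsto (fun e : ℕ => c * ((p ^ e : ℕ) : ℝ) ^ (1 / 2 : ℝ)) atTop atTop :=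
    ((tendsto_rpow_atTop (by norm_num)).comp
      (tendsto_natCast_atTop_atTop.comp hpow)).const_mul_atTop hc
  obtain ⟨e, h1, h2, h3⟩ := ((hpow.eventually hct).and ((hpow.eventually
    (hε.eventually (gt_mem_nhds (by norm_num : (0 : ℝ) < 1 / 2)))).and
      (hlim.eventually_gt_atTop (C : ℝ)))).exists
  have h4 := h _ (OrderSequence.primePow_constantSparseness hp) e (by
    simpa [OrderSequence.primePow] using fun h0 => absurd h0 hpk)
  have h5 : (degreeFunction k (p ^ e) : ℝ) ≤ C := by exact_mod_cast hC e
  have h6 : ((p ^ e : ℕ) : ℝ) ^ (1 / 2 : ℝ) ≤ ((p ^ e : ℕ) : ℝ) ^ (1 - ε (p ^ e)) :=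
    Real.rpow_le_rpow_of_exponent_le (by exact_mod_cast Nat.one_le_pow _ _ hp.pos) (by linarith)
  have h7 := mul_le_mul_of_nonneg_left h6 hc.le
  have h8 : t (p ^ e) ≤ degreeFunction k (p ^ e) := h4
  linarith

theorem isLittleO_log_log_natCast :
    (fun n : ℕ => Real.log (Real.log n)) =o[atTop] (fun n : ℕ => (n : ℝ)) :=
  ((Real.isLittleO_log_id_atTop.comp_tendsto Real.tendsto_log_atTop).trans
    Real.isLittleO_log_id_atTop).comp_tendsto tendsto_natCast_atTop_atTop

theorem tendsto_log_log_natCast : Tendsto (fun n : ℕ => Real.log (Real.log n)) atTop atTop :=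
  Real.tendsto_log_atTop.comp (Real.tendsto_log_atTop.comp tendsto_natCast_atTop_atTop)

/-- Of the growth condition only t(n) = o(n) is needed, because the alternative is linear growth of
f on the n_i'. -/
theorem IsFastWith.exists_prime {t : ℕ → ℝ}
    (ht : t =o[atTop] (fun n : ℕ => Real.log (Real.log n))) (h : IsFastWith k t) :
    ∃ p : ℕ, p.Prime ∧ (p : k) ≠ 0 ∧ ∃ C, ∀ e, degreeFunction k (p ^ e) ≤ C := by
  by_contra hcon
  push Not at hcon
  obtain ⟨𝒩, hs, hf⟩ := h
  obtain ⟨Q, hQ⟩ := hs.exists_prime_le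
  obtain ⟨c, hc⟩ := exists_le_mul_degreeFunction (k := k) (fun p hp hpk => by
    push Not; exact hcon p hp hpk) Q
  have hsnd (i) : 𝒩.snd i ≤ c * 𝒩.fst i :=
    (hc _ (𝒩.natCast_snd_ne_zero i) fun p hp hd => hQ i p hp (hd.mul_left _)).trans
      (Nat.mul_le_mul_left _ (𝒩.degreeFunction_snd_le i))
  have hfst (i) : 𝒩.fst i ≤ c * degreeFunction k (𝒩.fst i) :=
    hc _ (hf i).1 fun p hp hd => hQ i p hp (hd.mul_right _)
  -- From n_i'' ≤ c·n_i' follows i ≤ n_i ≤ c·(n_i')^2.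
  have hlim : Tendsto 𝒩.fst atTop atTop := by
    rw [tendsto_atTop]
    intro b
    filter_upwards [eventually_gt_atTop (c * b ^ 2)] with i hi
    by_contra hlt
    have h1 : 𝒩.elt i ≤ c * 𝒩.fst i ^ 2 := by
      calc 𝒩.fst i * 𝒩.snd i ≤ 𝒩.fst i * (c * 𝒩.fst i) := Nat.mul_le_mul_left _ (hsnd i)
        _ = _ := by ring
    have h2 : c * 𝒩.fst i ^ 2 ≤ c * b ^ 2 :=
      Nat.mul_le_mul_left _ (Nat.pow_le_pow_left (by omega) 2)
    have := 𝒩.le_elt i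
    omega
  have hc0 : (0 : ℝ) < c + 1 := by positivity
  obtain ⟨i, hi⟩ := (hlim.eventually
    ((ht.trans isLittleO_log_log_natCast).bound (inv_pos.mpr hc0))).exists
  have h1 : (0 : ℝ) < 𝒩.fst i := by exact_mod_cast 𝒩.fst_pos i
  have h2 : (𝒩.fst i : ℝ) ≤ c * t (𝒩.fst i) := by
    calc (𝒩.fst i : ℝ) ≤ c * degreeFunction k (𝒩.fst i) := by exact_mod_cast hfst i
      _ ≤ _ := by gcongr; exact (hf i).2
  have h3 : t (𝒩.fst i) ≤ (c + 1 : ℝ)⁻¹ * 𝒩.fst i := by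
    have := (le_abs_self _).trans hi
    simpa using this
  have h4 : (c + 1 : ℝ) * t (𝒩.fst i) ≤ 𝒩.fst i := by
    calc (c + 1 : ℝ) * t (𝒩.fst i) ≤ (c + 1) * ((c + 1 : ℝ)⁻¹ * 𝒩.fst i) := by gcongr
      _ = _ := by field_simp
  have h5 : 0 < t (𝒩.fst i) := by
    by_contra hneg
    have : (c : ℝ) * t (𝒩.fst i) ≤ 0 := mul_nonpos_of_nonneg_of_nonpos (by positivity) (by linarith)
    linarith
  linarith

theorem IsFast.exists_isFastWith (h : IsFast k) :
    ∃ t : ℕ → ℝ, t =o[atTop] (fun n : ℕ => Real.log (Real.log n)) ∧ IsFastWith k t := by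
  obtain ⟨𝒩, hs, C, hC⟩ := h
  refine ⟨fun _ => C, ?_, 𝒩, hs, fun i => ⟨(hC i).1, Nat.cast_le.mpr (hC i).2⟩⟩
  exact Asymptotics.isLittleO_const_left.mpr
    (Or.inr (tendsto_norm_atTop_atTop.comp tendsto_log_log_natCast))

end FastSlow

/-! ### The lower bound for slow fields -/

section LowerBound

variable {k : Type u} [Field k]

/-- This is the induction step for the potential, with u and v the values of log N + log c before
and after a recursive step. It follows from u ≤ 2v and v·log(u/v) ≤ u - v. The factor 2 comes from
the doubled number of products, and 6 from the six DFTs. -/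
theorem mul_max_log_sub_le {u v b : ℝ} (hv : 0 < v) (hvu : v ≤ u) (huv : u ≤ 2 * v) :
    u * max 0 (Real.log u - b) ≤ 6 * (u - v) + 2 * (v * max 0 (Real.log v - b)) := by
  have hmax : 0 ≤ max 0 (Real.log v - b) := le_max_left _ _
  have hv' := mul_nonneg hv.le hmax
  rcases le_total (Real.log u - b) 0 with h | h
  · rw [max_eq_left h]
    linarith
  rw [max_eq_right h]
  have h1 : v * (Real.log u - Real.log v) ≤ u - v := by
    have h2 := Real.log_le_sub_one_of_pos (div_pos (hv.trans_le hvu) hv)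
    rw [Real.log_div (hv.trans_le hvu).ne' hv.ne'] at h2
    calc v * (Real.log u - Real.log v) ≤ v * (u / v - 1) := by gcongr
      _ = u - v := by field_simp
  have h3 : v * (Real.log v - b) ≤ v * max 0 (Real.log v - b) := by
    gcongr
    exact le_max_right _ _
  have h4 : u * (Real.log u - b) ≤ 2 * v * (Real.log u - b) := by gcongr
  have h5 : 2 * v * (Real.log u - b) =
      2 * (v * (Real.log v - b)) + 2 * (v * (Real.log u - Real.log v)) := by ring
  linarith

theorem StepData.le_overhead (d : StepData k) (h : 0 < d.order) :
    6 * ((d.modulus.natDegree : ℝ) * (d.order * Real.log d.order)) ≤ d.overhead := by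
  have h1 := d.fft.le_cost d.modulus d.ω h
  have h2 := d.fft.le_cost d.modulus (d.ω ^ (d.order - 1)) h
  have h3 : 4 * d.fft.cost d.modulus d.ω + 2 * d.fft.cost d.modulus (d.ω ^ (d.order - 1)) ≤
      d.overhead := by
    rw [StepData.overhead]
    omega
  have h4 : 4 * (d.fft.cost d.modulus d.ω : ℝ) +
      2 * d.fft.cost d.modulus (d.ω ^ (d.order - 1)) ≤ d.overhead := by exact_mod_cast h3
  change (d.modulus.natDegree : ℝ) * (d.order * Real.log d.order) ≤ _ at h1
  change (d.modulus.natDegree : ℝ) * (d.order * Real.log d.order) ≤ _ at h2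
  linarith

/-- The left side is a potential N·u·max(0, log u - b) with u = log N + log c. Adding log c turns
N'' ≤ c·N' into u ≤ 2v, and the truncation by b makes the potential vanish where the recursion may
stop. -/
theorem Scheme.le_cost (𝒩 : OrderSequence k) (B c : ℕ) (hc : 3 ≤ c)
    (H : ∀ i, 𝒩.snd i ≤ c * 𝒩.fst i) (b : ℝ)
    (hb : ∀ N : ℕ, 0 < N → N ≤ B → Real.log (Real.log N + Real.log c) ≤ b)
    (s : Scheme k) (P : k[X]) (hP : 0 < P.natDegree) (hs : s.Valid 𝒩 B P) :
    P.natDegree * ((Real.log P.natDegree + Real.log c) *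
      max 0 (Real.log (Real.log P.natDegree + Real.log c) - b)) ≤ s.cost P := by
  induction s generalizing P with
  | base =>
    have := hb _ hP hs
    rw [max_eq_left (by linarith)]
    simp
  | step d next ih =>
    obtain ⟨-, hPe, ⟨i, hi1, hi2⟩, hnext⟩ := hs
    have hm : 0 < d.modulus.natDegree := hi1 ▸ 𝒩.fst_pos i
    have hn : 0 < d.order := hi2 ▸ 𝒩.snd_pos i
    have hle : d.order ≤ c * d.modulus.natDegree := by rw [hi1, hi2]; exact H i
    have hdeg : P.natDegree = d.modulus.natDegree * d.order := by rw [hPe, natDegree_expand]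
    have ih' := ih d.modulus hm hnext
    have ho := d.le_overhead hn
    rw [Scheme.cost]
    generalize d.modulus.natDegree = m at *
    generalize d.order = n at *
    have hmR : (0 : ℝ) < m := by exact_mod_cast hm
    have hnR : (0 : ℝ) < n := by exact_mod_cast hn
    have hcR : (0 : ℝ) < c := by positivity
    have hlog : Real.log n ≤ Real.log c + Real.log m := by
      rw [← Real.log_mul hcR.ne' hmR.ne']
      exact Real.log_le_log hnR (by exact_mod_cast hle)
    have hc1 : 0 < Real.log c := Real.log_pos (by exact_mod_cast (by omega : 1 < c))
    have hm1 : 0 ≤ Real.log m := Real.log_natCast_nonneg m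
    have hn1 : 0 ≤ Real.log n := Real.log_natCast_nonneg n
    have key := mul_max_log_sub_le (u := Real.log m + Real.log n + Real.log c)
      (v := Real.log m + Real.log c) (b := b) (by linarith) (by linarith) (by linarith)
    rw [hdeg]
    push_cast
    rw [Real.log_mul hmR.ne' hnR.ne']
    calc (m : ℝ) * n * ((Real.log m + Real.log n + Real.log c) *
          max 0 (Real.log (Real.log m + Real.log n + Real.log c) - b))
        ≤ m * n * (6 * (Real.log m + Real.log n + Real.log c - (Real.log m + Real.log c)) +
          2 * ((Real.log m + Real.log c) *
            max 0 (Real.log (Real.log m + Real.log c) - b))) := by gcongr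
      _ = 6 * (m * (n * Real.log n)) + 2 * n * (m * ((Real.log m + Real.log c) *
            max 0 (Real.log (Real.log m + Real.log c) - b))) := by ring
      _ ≤ d.overhead + 2 * n * next.cost d.modulus := by gcongr

theorem Algorithm.isBigO_cost
    (h : ∀ p : ℕ, p.Prime → (p : k) ≠ 0 → ¬ ∃ C, ∀ e, degreeFunction k (p ^ e) ≤ C)
    (D : Algorithm k) :
    (fun n : ℕ => (n : ℝ) * Real.log n * Real.log (Real.log n)) =O[atTop]
      (fun n : ℕ => (D.cost n : ℝ)) := by
  obtain ⟨Q, hQ⟩ := D.sparse.exists_prime_le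
  obtain ⟨c, hc⟩ := exists_le_mul_degreeFunction h Q
  have H (i) : D.seq.snd i ≤ (c + 3) * D.seq.fst i :=
    ((hc _ (D.seq.natCast_snd_ne_zero i) fun p hp hd => hQ i p hp (hd.mul_left _)).trans
      (Nat.mul_le_mul_left _ (D.seq.degreeFunction_snd_le i))).trans
        (Nat.mul_le_mul_right _ (by omega))
  have hc1 : 0 < Real.log ((c + 3 : ℕ) : ℝ) :=
    Real.log_pos (by exact_mod_cast (by omega : 1 < c + 3))
  set b := Real.log (Real.log (D.bound : ℝ) + Real.log ((c + 3 : ℕ) : ℝ)) with hb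
  have hb' (N : ℕ) (h0 : 0 < N) (hN : N ≤ D.bound) :
      Real.log (Real.log N + Real.log ((c + 3 : ℕ) : ℝ)) ≤ b := by
    have hN0 : (0 : ℝ) < N := by exact_mod_cast h0
    have := Real.log_natCast_nonneg N
    apply Real.log_le_log (by linarith)
    gcongr
  refine Asymptotics.IsBigO.of_bound 2 ?_
  -- Once log log n ≥ 2b, subtracting b loses at most half, whence the constant 2.
  filter_upwards [eventually_ge_atTop 3, tendsto_log_log_natCast.eventually_ge_atTop (2 * b),
    tendsto_log_log_natCast.eventually_ge_atTop 0] with n hn hlb hl0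
  obtain ⟨-, -, hge, -, hvalid⟩ := D.valid n (by omega)
  have hN : n ≤ (D.modulus n).natDegree := by omega
  have hcost := Scheme.le_cost D.seq D.bound (c + 3) (by omega) H b hb' (D.scheme n) (D.modulus n)
    (by omega) hvalid
  rw [← D.cost_eq] at hcost
  generalize (D.modulus n).natDegree = N at *
  have hn0 : (0 : ℝ) < n := by exact_mod_cast (by omega : 0 < n)
  have hlogn : 0 < Real.log n := Real.log_pos (by exact_mod_cast (by omega : 1 < n))
  have hlogN : Real.log n ≤ Real.log N + Real.log ((c + 3 : ℕ) : ℝ) := by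
    have : Real.log n ≤ Real.log N := Real.log_le_log hn0 (by exact_mod_cast hN)
    linarith
  have hmain : (n : ℝ) * (Real.log n * (Real.log (Real.log n) / 2)) ≤ D.cost n := by
    refine le_trans ?_ hcost
    gcongr
    refine le_max_of_le_right ?_
    have := Real.log_le_log hlogn hlogN
    linarith
  rw [Real.norm_of_nonneg (by positivity), Real.norm_of_nonneg (by positivity)]
  linarith

end LowerBound

/-! ### An instance with `O(n log n)` operations -/

section UpperBound

open IntermediateField

variable {k : Type u} [Field k]

/-- If the degree function is bounded on the powers of `p`, then all roots of unity of order a power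
of `p` lie in one simple extension of finite degree. -/
theorem exists_irreducible_forall_isPrimitiveRoot {p : ℕ} (hp : p.Prime) (hpk : (p : k) ≠ 0)
    (h : ∃ C, ∀ e, degreeFunction k (p ^ e) ≤ C) :
    ∃ P : k[X], P.Monic ∧ Irreducible P ∧ ∀ e, ∃ ω : AdjoinRoot P, IsPrimitiveRoot ω (p ^ e) := by
  have hne : ∀ e, ((p ^ e : ℕ) : k) ≠ 0 := fun e => by push_cast; exact pow_ne_zero _ hpk
  have hpos : ∀ e, 0 < p ^ e := fun e => pow_pos hp.pos e
  obtain ⟨C, hC⟩ := h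
  have hfin : (Set.range fun e => degreeFunction k (p ^ e)).Finite :=
    (Set.finite_Iic C).subset (by rintro _ ⟨e, rfl⟩; exact hC e)
  -- Take p^a of maximal degree and z of that order. For w of order p^(a+e), k(z) lies in k(w), and
  -- maximality forces equality, so k(z) contains w^(p^a), of order p^e.
  obtain ⟨_, ⟨a, rfl⟩, ha⟩ := Set.exists_max_image _ id hfin ⟨_, 0, rfl⟩
  obtain ⟨z, hz⟩ := exists_isPrimitiveRoot_of_ne_zero (hne a)
  have hint : IsIntegral k z := Algebra.IsIntegral.isIntegral z
  refine ⟨minpoly k z, minpoly.monic hint, minpoly.irreducible hint, fun e => ?_⟩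
  obtain ⟨w, hw⟩ := exists_isPrimitiveRoot_of_ne_zero (hne (a + e))
  have hwz : IsPrimitiveRoot (w ^ p ^ e) (p ^ a) :=
    hw.pow (hpos _) (by rw [pow_add, mul_comm])
  have hwe : IsPrimitiveRoot (w ^ p ^ a) (p ^ e) := hw.pow (hpos _) (pow_add p a e)
  have : NeZero (p ^ a) := ⟨(hpos a).ne'⟩
  obtain ⟨i, -, hi⟩ := hwz.eq_pow_of_pow_eq_one hz.pow_eq_one
  have hzw : z ∈ k⟮w⟯ := by
    rw [← hi]
    exact pow_mem (pow_mem (mem_adjoin_simple_self k w) _) _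
  have hle : k⟮z⟯ ≤ k⟮w⟯ := adjoin_simple_le_iff.mpr hzw
  have hdim : Module.finrank k k⟮w⟯ ≤ Module.finrank k k⟮z⟯ := by
    rw [← degreeFunction_eq (hpos _).ne' hz, ← degreeFunction_eq (hpos _).ne' hw]
    exact ha _ ⟨a + e, rfl⟩
  have := finiteDimensional_adjoin_simple w
  have heq : k⟮z⟯ = k⟮w⟯ := eq_of_le_of_finrank_le hle hdim
  have hmem : w ^ p ^ a ∈ k⟮z⟯ := by
    rw [heq]
    exact pow_mem (mem_adjoin_simple_self k w) _
  have hprim : IsPrimitiveRoot (⟨w ^ p ^ a, hmem⟩ : k⟮z⟯) (p ^ e) :=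
    IsPrimitiveRoot.of_map_of_injective (f := k⟮z⟯.val) hwe Subtype.val_injective
  exact ⟨(adjoinRootEquivAdjoin k hint).symm ⟨_, hmem⟩,
    hprim.map_of_injective (adjoinRootEquivAdjoin k hint).symm.injective⟩

theorem isPrincipalRoot_of_isPrimitiveRoot {A : Type*} [Field A] {ω : A} {n : ℕ}
    (h : IsPrimitiveRoot ω n) : IsPrincipalRoot ω n :=
  ⟨h.pow_eq_one, fun ν h1 h2 => mem_nonZeroDivisors_of_ne_zero
    (sub_ne_zero.mpr (h.pow_ne_one_of_pos_of_lt (by omega) h2).symm)⟩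

/-! ### The instance with one recursive step over a fixed extension field. -/

variable {P : k[X]} {p : ℕ}

/-- The order sequence `deg P, p deg P, p² deg P, …`. -/
noncomputable def OrderSequence.ofModulus (hp : p.Prime) (hP : P.Monic) (hirr : Irreducible P)
    (h : ∀ e, ∃ ω : AdjoinRoot P, IsPrimitiveRoot ω (p ^ e)) : OrderSequence k where
  fst _ := P.natDegree
  snd i := p ^ i
  lt i := Nat.mul_lt_mul_of_pos_left (Nat.pow_lt_pow_right hp.one_lt (Nat.lt_succ_self i))
    hirr.natDegree_pos
  dvd i := mul_dvd_mul_left _ (pow_dvd_pow p (Nat.le_succ i))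
  ext := by
    have : Fact (Irreducible P) := ⟨hirr⟩
    -- The FFT takes at most 2p·i·p^i operations, and i = log(p^i)/log p.
    refine ⟨p * 2 / Real.log p, fun i => ⟨AdjoinRoot P, inferInstance, inferInstance, ?_, ?_⟩⟩
    · rw [(AdjoinRoot.powerBasis hP.ne_zero).finrank, AdjoinRoot.powerBasis_dim]
    · obtain ⟨ω, hω⟩ := h i
      refine ⟨ω, isPrincipalRoot_of_isPrimitiveRoot hω, ?_⟩
      have hle := complexity_dft_le p i ω hω.pow_eq_one
      have hlog : 0 < Real.log p := Real.log_pos (by exact_mod_cast hp.one_lt)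
      calc (complexity (dft ω (p ^ i)) : ℝ) ≤ ((i * p ^ i * (p * 2) : ℕ) : ℝ) := by
            exact_mod_cast hle
        _ = p * 2 / Real.log p * ((p ^ i : ℕ) : ℝ) * Real.log ((p ^ i : ℕ) : ℝ) := by
            push_cast
            rw [Real.log_pow]
            field_simp

theorem OrderSequence.ofModulus_constantSparseness (hp : p.Prime) (hP : P.Monic)
    (hirr : Irreducible P) (h : ∀ e, ∃ ω : AdjoinRoot P, IsPrimitiveRoot ω (p ^ e)) :
    (OrderSequence.ofModulus hp hP hirr h).ConstantSparseness := by
  have h2 : (1 : ℝ) < p := by exact_mod_cast hp.one_lt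
  refine ⟨fun _ => p, p, ⟨fun _ => h2, fun i => le_of_eq ?_⟩, fun _ => le_rfl⟩
  simp only [OrderSequence.elt, OrderSequence.ofModulus]
  push_cast
  ring

/-- Take γ₁ = 1 and γ₂ a primitive root of order p^(e+1). Then γ₂^(p^e) ≠ 1, so the difference is a
unit of the field k[x]/(P). -/
theorem exists_stepData (hp : p.Prime) (hP : P.Monic) (hirr : Irreducible P)
    (h : ∀ e, ∃ ω : AdjoinRoot P, IsPrimitiveRoot ω (p ^ e)) (e : ℕ) :
    ∃ d : StepData k, d.modulus = P ∧ d.fft = FFTPlan.radix p e ∧ d.Valid := by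
  have : Fact (Irreducible P) := ⟨hirr⟩
  obtain ⟨ω, hω⟩ := h e
  obtain ⟨g, hg⟩ := h (e + 1)
  have hg0 : g ≠ 0 := hg.ne_zero (pow_pos hp.pos _).ne'
  have hg1 : 1 - g ^ p ^ e ≠ 0 := sub_ne_zero.mpr (hg.pow_ne_one_of_pos_of_lt
    (pow_pos hp.pos _).ne' (Nat.pow_lt_pow_right hp.one_lt (Nat.lt_succ_self e))).symm
  obtain ⟨w, rfl⟩ := AdjoinRoot.mk_surjective ω
  obtain ⟨y, rfl⟩ := AdjoinRoot.mk_surjective g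
  obtain ⟨y', hy'⟩ := AdjoinRoot.mk_surjective (AdjoinRoot.mk P y)⁻¹
  obtain ⟨δ, hδ⟩ := AdjoinRoot.mk_surjective (1 - AdjoinRoot.mk P y ^ p ^ e)⁻¹
  refine ⟨⟨P, FFTPlan.radix p e, w, 1, y, 1, y', δ⟩, rfl, rfl, hP, ?_, ?_, ?_, ?_⟩
  · simpa only [StepData.order, FFTPlan.order_radix] using isPrincipalRoot_of_isPrimitiveRoot hω
  · simp
  · rw [map_mul, hy', mul_inv_cancel₀ hg0]
  · simp only [StepData.order, FFTPlan.order_radix]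
    rw [map_mul, map_sub, map_pow, map_pow, map_one, one_pow, hδ, mul_inv_cancel₀ hg1]

theorem exists_overhead_le (P : k[X]) (p : ℕ) : ∃ K : ℕ, ∀ (d : StepData k) (e : ℕ),
    d.modulus = P → d.fft = FFTPlan.radix p e → d.overhead ≤ (e + 1) * p ^ e * K := by
  obtain ⟨M, hM⟩ : ∃ M, ∀ w, scaleCost P w ≤ M := ⟨_, scaleCost_le P⟩
  -- Per index there are six DFT shares, nine scalings (six twists, three in the recombination) and
  -- three additions or subtractions.
  refine ⟨6 * (p * (M + P.natDegree) + M) + (9 * M + 3 * P.natDegree), fun d e hd hf => ?_⟩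
  have hs (n : ℕ) (f : ℕ → k[X]) : ∑ i ∈ Finset.range n, scaleCost P (f i) ≤ n * M :=
    (Finset.sum_le_card_nsmul _ _ M fun i _ => hM _).trans (by simp)
  have ho : d.order = p ^ e := by rw [StepData.order, hf, FFTPlan.order_radix]
  rw [StepData.overhead, hd, hf, ho]
  calc _ ≤ 2 * (p ^ e * M) + 2 * (p ^ e * M) +
        4 * ((e + 1) * p ^ e * (p * (M + P.natDegree) + M)) +
        2 * ((e + 1) * p ^ e * (p * (M + P.natDegree) + M)) + p ^ e * M + p ^ e * M +
        p ^ e * (3 * P.natDegree + M + M + M) := by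
        gcongr
        any_goals exact hs _ _
        any_goals exact FFTPlan.cost_radix_le P M hM p e _
        any_goals exact hM _
    _ = 6 * ((e + 1) * p ^ e * (p * (M + P.natDegree) + M)) +
        1 * p ^ e * (9 * M + 3 * P.natDegree) := by ring
    _ ≤ 6 * ((e + 1) * p ^ e * (p * (M + P.natDegree) + M)) +
        (e + 1) * p ^ e * (9 * M + 3 * P.natDegree) := by gcongr; omega
    _ = _ := by ring

theorem pow_clog_le (hp : 1 < p) {n : ℕ} (hn : 1 ≤ n) : p ^ Nat.clog p (2 * n) ≤ p * (2 * n) := by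
  have h1 : 0 < Nat.clog p (2 * n) := Nat.clog_pos hp (by omega)
  have h2 := Nat.pow_pred_clog_lt_self hp (x := 2 * n) (by omega)
  calc p ^ Nat.clog p (2 * n) = p * p ^ (Nat.clog p (2 * n)).pred := by
        rw [← pow_succ']
        exact congrArg _ (Nat.succ_pred_eq_of_pos h1).symm
    _ ≤ _ := Nat.mul_le_mul_left _ h2.le

theorem clog_add_one_le (hp : 1 < p) {n : ℕ} (hn : 2 * p ≤ n) :
    ((Nat.clog p (2 * n) : ℝ) + 1) * Real.log 2 ≤ 3 * Real.log n := by
  have hn0 : (0 : ℝ) < n := by exact_mod_cast (by omega : 0 < n)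
  have h1 : (2 : ℝ) ^ Nat.clog p (2 * n) ≤ (n : ℝ) * n := by
    calc (2 : ℝ) ^ Nat.clog p (2 * n) ≤ (p : ℝ) ^ Nat.clog p (2 * n) := by
          gcongr; exact_mod_cast hp
      _ ≤ p * (2 * n) := by exact_mod_cast pow_clog_le hp (by omega)
      _ = (2 * p) * n := by ring
      _ ≤ n * n := by gcongr; exact_mod_cast hn
  have h2 := Real.log_le_log (by positivity) h1
  rw [Real.log_pow, Real.log_mul hn0.ne' hn0.ne'] at h2
  have h3 : Real.log 2 ≤ Real.log n := Real.log_le_log (by norm_num) (by exact_mod_cast (by omega))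
  linarith

theorem exists_algorithm_isBigO (hp : p.Prime) (hP : P.Monic) (hirr : Irreducible P)
    (h : ∀ e, ∃ ω : AdjoinRoot P, IsPrimitiveRoot ω (p ^ e)) :
    ∃ D : Algorithm k, (fun n : ℕ => (D.cost n : ℝ)) =O[atTop]
      (fun n : ℕ => (n : ℝ) * Real.log n) := by
  choose d hdP hdf hdv using exists_stepData hp hP hirr h
  have ho (e : ℕ) : (d e).order = p ^ e := by rw [StepData.order, hdf, FFTPlan.order_radix]
  have hD : 0 < P.natDegree := hirr.natDegree_pos
  let D : Algorithm k :=
    { seq := OrderSequence.ofModulus hp hP hirr h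
      sparse := OrderSequence.ofModulus_constantSparseness hp hP hirr h
      bound := P.natDegree
      ratio := P.natDegree * (p * 2)
      -- The exponent is the least with p^e ≥ 2n, so N = p^e·deg P is at least 2n and at most 2p·deg
      -- P·n. One step leads to P itself, where products have constant cost.
      modulus := fun n => expand k (p ^ Nat.clog p (2 * n)) P
      scheme := fun n => .step (d (Nat.clog p (2 * n))) .base
      valid := by
        intro n hn
        refine ⟨hP.expand (pow_pos hp.pos _), ⟨Nat.clog p (2 * n), natDegree_expand _ _⟩, ?_, ?_,
          hdv _, ?_, ⟨Nat.clog p (2 * n), ?_, ho _⟩, ?_⟩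
        · rw [natDegree_expand]
          exact (Nat.sub_le _ _).trans ((Nat.le_pow_clog hp.one_lt (2 * n)).trans
            (Nat.le_mul_of_pos_left _ hD))
        · rw [natDegree_expand, mul_assoc, mul_assoc]
          exact Nat.mul_le_mul_left _ (pow_clog_le hp.one_lt hn)
        · rw [ho, hdP]
        · rw [hdP]; rfl
        · rw [hdP]; exact le_rfl }
  refine ⟨D, ?_⟩
  obtain ⟨K, hK⟩ := exists_overhead_le P p
  have hcost (n : ℕ) : D.cost n ≤ (Nat.clog p (2 * n) + 1) * p ^ Nat.clog p (2 * n) *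
      (K + 2 * mulCost P) := by
    rw [D.cost_eq]
    change (d _).overhead + 2 * (d _).order * mulCost (d _).modulus ≤ _
    rw [ho, hdP, mul_add]
    refine add_le_add (hK _ _ (hdP _) (hdf _)) ?_
    calc 2 * p ^ Nat.clog p (2 * n) * mulCost P
        = 1 * p ^ Nat.clog p (2 * n) * (2 * mulCost P) := by ring
      _ ≤ _ := by gcongr; omega
  refine Asymptotics.IsBigO.of_bound (3 / Real.log 2 * (p * 2) * (K + 2 * mulCost P)) ?_
  filter_upwards [eventually_ge_atTop (2 * p)] with n hn
  have hn1 : 1 ≤ n := by have := hp.pos; omega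
  have hlogn := Real.log_natCast_nonneg n
  have hlog2 : 0 < Real.log 2 := Real.log_pos (by norm_num)
  rw [Real.norm_of_nonneg (by positivity), Real.norm_of_nonneg (by positivity)]
  have h1 : (Nat.clog p (2 * n) : ℝ) + 1 ≤ 3 * Real.log n / Real.log 2 := by
    rw [le_div_iff₀ hlog2]
    exact clog_add_one_le hp.one_lt hn
  have h2 : (p : ℝ) ^ Nat.clog p (2 * n) ≤ p * (2 * n) := by
    exact_mod_cast pow_clog_le hp.one_lt hn1
  calc (D.cost n : ℝ) ≤ (Nat.clog p (2 * n) + 1) * (p : ℝ) ^ Nat.clog p (2 * n) *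
        (K + 2 * mulCost P) := by exact_mod_cast hcost n
    _ ≤ (3 * Real.log n / Real.log 2) * (p * (2 * n)) * (K + 2 * mulCost P) := by gcongr
    _ = _ := by ring

theorem IsFastWith.exists_algorithm {t : ℕ → ℝ}
    (ht : t =o[atTop] (fun n : ℕ => Real.log (Real.log n))) (h : IsFastWith k t) :
    ∃ D : Algorithm k, (fun n : ℕ => (D.cost n : ℝ)) =O[atTop]
      (fun n : ℕ => (n : ℝ) * Real.log n) := by
  obtain ⟨p, hp, hpk, hC⟩ := h.exists_prime ht
  obtain ⟨P, hP, hirr, hω⟩ := exists_irreducible_forall_isPrimitiveRoot hp hpk hC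
  exact exists_algorithm_isBigO hp hP hirr hω

end UpperBound

end DFTMul

/-! ### The three bounds assembled. -/

theorem mainTheorem2 (k : Type*) [Field k] :
    (DFTMul.IsFast k →
      ∃ D : DFTMul.Algorithm k,
        (fun n : ℕ => (D.cost n : ℝ)) =O[Filter.atTop]
          (fun n : ℕ => (n : ℝ) * Real.log n)) ∧
    (∀ t : ℕ → ℝ,
      t =o[Filter.atTop] (fun n : ℕ => Real.log (Real.log n)) →
      DFTMul.IsFastWith k t →
      ∃ D : DFTMul.Algorithm k,
        (fun n : ℕ => (D.cost n : ℝ)) =o[Filter.atTop]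
          (fun n : ℕ => (n : ℝ) * Real.log n * Real.log (Real.log n))) ∧
    (∀ t : ℕ → ℝ,
      DFTMul.IsOmegaNearlyLinear t →
      DFTMul.IsSlowWith k t →
      ∀ D : DFTMul.Algorithm k,
        (fun n : ℕ => (n : ℝ) * Real.log n * Real.log (Real.log n)) =O[Filter.atTop]
          (fun n : ℕ => (D.cost n : ℝ))) := by
  refine ⟨fun h => ?_, fun t ht h => ?_, fun t ht h D => ?_⟩
  · obtain ⟨t, ht, h⟩ := h.exists_isFastWith
    exact h.exists_algorithm ht
  · obtain ⟨D, hD⟩ := h.exists_algorithm ht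
    refine ⟨D, hD.trans_isLittleO ?_⟩
    have h1 : (fun _ : ℕ => (1 : ℝ)) =o[Filter.atTop] fun n : ℕ => Real.log (Real.log n) :=
      Asymptotics.isLittleO_const_left.mpr
        (Or.inr (tendsto_norm_atTop_atTop.comp DFTMul.tendsto_log_log_natCast))
    simpa using (Asymptotics.isBigO_refl (fun n : ℕ => (n : ℝ) * Real.log n)
      Filter.atTop).mul_isLittleO h1
  · exact D.isBigO_cost fun p hp hpk => h.unbounded ht hp hpk
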